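/- **Setting.** Let $\mathcal L\subseteq\mathbb R^d$ be countable with the Euclidean distance, and suppose it has effective dimension $\gamma>0$: there are $C,r_0\ge 0$ with $|B_r(z)\cap\mathcal L|\le C r^\gamma$ for all $r\ge r_0$, $z\in\mathcal L$, where $B_r(z)=\{x\in\mathbb R^d: |x-z|<r\}$. Let $P_0(\mathcal L)$ be the set of finite nonempty subsets of $\mathcal L$. To every $x\in\mathcal L$ let a nonzero finite-dimensional complex Hilbert space $\mathcal H_x$ be given. For finite $\Lambda\subseteq\mathcal L$ let $\mathcal U_\Lambda=L(\bigotimes_{x\in\Lambda}\mathcal H_x)$, identified for $\Lambda\subseteq\Lambda'$ with a subalgebra of $\mathcal U_{\Lambda'}$ through $A\mapsto A\otimes\mathbb I$, and let the quasi-local algebra $\mathcal U$ be the norm completion of $\mathcal U_{\mathrm{loc}}=\bigcup_\Lambda\mathcal U_\Lambda$. The support $\mathrm{supp}(A)$ of $A\in\mathcal U_{\mathrm{loc}}$ is the smallest set $\Lambda$ with $A\in\mathcal U_\Lambda$. Let $(n_x)_{x\in\mathcal L}\subseteq\mathcal U_{\mathrm{loc}}$ be self-adjoint, pairwise commuting,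 with $\sup_x\|n_x\|<\infty$, and such that for some $R_0>0$ one has $\mathrm{supp}(n_x)\subseteq B_{R_0}(x)$ for all $x$. For $a\in\mathbb N_0^d$, $|a|=\sum_j a_j$, finite $\Lambda\subseteq\mathcal L$, $s\in\mathbb R$ and $A\in\mathcal U_\Lambda$ put $$\tau^{(a)}_s(A)=e^{-isQ^{(a)}_\Lambda}\,A\,e^{isQ^{(a)}_\Lambda},\qquad Q^{(a)}_\Lambda=\sum_{x\in\mathcal L:\ \mathrm{supp}(n_x)\cap\Lambda\neq\emptyset}x^a n_x,\qquad x^a=\prod_{j=1}^d x_j^{a_j}. \tag{1}$$ Let $k\in\mathbb N_0$ and let $\Phi=(\phi(\Lambda))_{\Lambda\in P_0(\mathcal L)}$ be an interaction, i.e. $\phi(\Lambda)=\phi(\Lambda)^*\in\mathcal U_\Lambda$ for all $\Lambda$. Assume that 1. $\tau^{(a)}_s(\phi(\Lambda))=\phi(\Lambda)$ for all $|a|\le k$, $\Lambda\in P_0(\mathcal L)$, $s\in\mathbb R$; 2. $\displaystyle\sup_{x\in\mathcal L}\ \sum_{\Lambda\in P_0(\mathcal L):\,x\in\Lambda}\|\phi(\Lambda)\|\Bigl(\sum_{z\in\mathcal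 L:\ \mathrm{supp}(n_z)\cap\Lambda\ne\emptyset}|z-x|^{k+1}\Bigr)^2<\infty$; 3. there is $\varepsilon>0$ with $\displaystyle\sup_{x,y\in\mathcal L}(1+|x-y|)^{\gamma+1+\varepsilon}\sum_{\Lambda\in P_0(\mathcal L):\,x,y\in\Lambda}\|\phi(\Lambda)\|<\infty$. **Proposition.** 1. $\Phi$ induces a time evolution: there is a unique strongly continuous one-parameter group $\alpha=(\alpha_t)_{t\in\mathbb R}$ of $*$-automorphisms of $\mathcal U$ such that, for every increasing sequence $(\Lambda_m)$ of finite subsets of $\mathcal L$ with $\bigcup_m\Lambda_m=\mathcal L$ and every $A\in\mathcal U$, $$\alpha_t(A)=\lim_{m\to\infty}\exp\Bigl(it\sum_{\Lambda\in P_0(\mathcal L),\,\Lambda\subseteq\Lambda_m}\phi(\Lambda)\Bigr)\,A\,\exp\Bigl(-it\sum_{\Lambda\in P_0(\mathcal L),\,\Lambda\subseteq\Lambda_m}\phi(\Lambda)\Bigr)$$ in norm, uniformly for $t$ in compact subsets of $\mathbb R$. 2. For every multi-index $a\in\mathbb N_0^d$ with $|a|\le k$, formula (1) extends to a unique strongly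 continuous one-parameter group $\tau^{(a)}=(\tau^{(a)}_s)_{s\in\mathbb R}$ of $*$-automorphisms of $\mathcal U$, and it is a symmetry of $(\mathcal U,\alpha)$: $$\alpha_t\circ\tau^{(a)}_s=\tau^{(a)}_s\circ\alpha_t\qquad\text{for all }t,s\in\mathbb R.$$ -/

import Mathlib

noncomputable section

namespace QuantumLattice

open scoped Kronecker

universe u v

/-! ### Finite volumes: the Hilbert space `H_Λ = ⨂_{x ∈ Λ} H_x` and the algebra `L(H_Λ)` -/

section FiniteVolume

variable {S : Type u} (H : S → Type v) [∀ x, NormedAddCommGroup (H x)]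
  [∀ x, InnerProductSpace ℂ (H x)]

/-- Labels of the product orthonormal basis of `⨂_{x ∈ Λ} H x`: one label of the standard
orthonormal basis of `H x` for every site `x ∈ Λ`. -/
def Conf (Λ : Finset S) : Type u := ∀ x : Λ, Fin (Module.finrank ℂ (H x))

instance (Λ : Finset S) : Finite (Conf H Λ) := by unfold Conf; infer_instance

instance (Λ : Finset S) : Fintype (Conf H Λ) := Fintype.ofFinite _

instance (Λ : Finset S) : DecidableEq (Conf H Λ) := Classical.decEq _

/-- The Hilbert space tensor product `⨂_{x ∈ Λ} H x`, in coordinates with respect to the product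
of the standard orthonormal bases; see `pureTensor`, `inner_pureTensor` and
`span_range_pureTensor`. -/
abbrev LocalSpace (Λ : Finset S) : Type u := EuclideanSpace ℂ (Conf H Λ)

/-- The C⋆-algebra `L(H_Λ)` of all (bounded) linear operators on `H_Λ`, with the operator norm. -/
def LocalOp (Λ : Finset S) : Type u := LocalSpace H Λ →L[ℂ] LocalSpace H Λ

instance (Λ : Finset S) : NormedRing (LocalOp H Λ) :=
  inferInstanceAs (NormedRing (LocalSpace H Λ →L[ℂ] LocalSpace H Λ))

instance (Λ : Finset S) : StarRing (LocalOp H Λ) :=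
  inferInstanceAs (StarRing (LocalSpace H Λ →L[ℂ] LocalSpace H Λ))

instance (Λ : Finset S) : CompleteSpace (LocalOp H Λ) :=
  inferInstanceAs (CompleteSpace (LocalSpace H Λ →L[ℂ] LocalSpace H Λ))

instance (Λ : Finset S) : CStarRing (LocalOp H Λ) :=
  inferInstanceAs (CStarRing (LocalSpace H Λ →L[ℂ] LocalSpace H Λ))

instance (Λ : Finset S) : NormedAlgebra ℂ (LocalOp H Λ) :=
  inferInstanceAs (NormedAlgebra ℂ (LocalSpace H Λ →L[ℂ] LocalSpace H Λ))

instance (Λ : Finset S) : StarModule ℂ (LocalOp H Λ) :=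
  inferInstanceAs (StarModule ℂ (LocalSpace H Λ →L[ℂ] LocalSpace H Λ))

instance (Λ : Finset S) : CStarAlgebra (LocalOp H Λ) where
  __ := (inferInstance : NormedAlgebra ℂ (LocalOp H Λ))
  __ := (inferInstance : StarModule ℂ (LocalOp H Λ))

/-- The operator with a given matrix in the product basis. -/
def LocalOp.ofMatrix (Λ : Finset S) : Matrix (Conf H Λ) (Conf H Λ) ℂ ≃⋆ₐ[ℂ] LocalOp H Λ :=
  Matrix.toEuclideanCLM (n := Conf H Λ) (𝕜 := ℂ)

variable [∀ x, FiniteDimensional ℂ (H x)]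

/-- The elementary tensor `⨂_{x ∈ Λ} v x`. -/
def pureTensor (Λ : Finset S) (v : ∀ x : Λ, H x) : LocalSpace H Λ :=
  WithLp.toLp 2 fun σ => ∏ x : Λ, (stdOrthonormalBasis ℂ (H x)).repr (v x) (σ x)

theorem inner_pureTensor (Λ : Finset S) (v w : ∀ x : Λ, H x) :
    inner ℂ (pureTensor H Λ v) (pureTensor H Λ w) = ∏ x : Λ, inner ℂ (v x) (w x) := by
  classical
  have h : ∀ x : Λ, inner ℂ (v x) (w x) = ∑ i, (stdOrthonormalBasis ℂ (H x)).repr (w x) i *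
      star ((stdOrthonormalBasis ℂ (H x)).repr (v x) i) := by
    intro x
    rw [← (stdOrthonormalBasis ℂ (H x)).repr.inner_map_map, PiLp.inner_apply]
    rfl
  simp only [h, Finset.prod_univ_sum, PiLp.inner_apply, pureTensor]
  refine Finset.sum_nbij' (fun σ => σ) (fun σ => σ) ?_ ?_ ?_ ?_ ?_
  · intro σ _
    exact Fintype.mem_piFinset.mpr fun _ => Finset.mem_univ _
  · intro σ _
    exact Finset.mem_univ _
  · intro σ _; rfl
  · intro σ _; rfl
  · intro σ _
    simp [Finset.prod_mul_distrib, mul_comm]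

theorem span_range_pureTensor (Λ : Finset S) :
    Submodule.span ℂ (Set.range (pureTensor H Λ)) = ⊤ := by
  classical
  rw [eq_top_iff, ← (EuclideanSpace.basisFun (Conf H Λ) ℂ).toBasis.span_eq]
  refine Submodule.span_mono ?_
  rintro _ ⟨σ, rfl⟩
  refine ⟨fun x => stdOrthonormalBasis ℂ (H x) (σ x), ?_⟩
  ext τ
  simp only [pureTensor, OrthonormalBasis.repr_self, OrthonormalBasis.coe_toBasis,
    EuclideanSpace.basisFun_apply, PiLp.single_apply]
  by_cases h : τ = σ
  · subst h; simp
  · rw [if_neg h]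
    obtain ⟨x, hx⟩ := Function.ne_iff.mp h
    exact Finset.prod_eq_zero (Finset.mem_univ x) (by simp [hx])

end FiniteVolume

/-! ### The inclusions `L(H_Λ₁) → L(H_Λ₂)`, `A ↦ A ⊗ 1` -/

section Inclusion

variable {S : Type u} (H : S → Type v) [∀ x, NormedAddCommGroup (H x)]
  [∀ x, InnerProductSpace ℂ (H x)] {Λ₁ Λ₂ Λ₃ : Finset S}

open scoped Classical in
/-- The labels of the product basis of `H_Λ₂` are pairs of labels for `Λ₁` and `Λ₂ \ Λ₁`; this
expresses `H_Λ₂ = H_Λ₁ ⊗ H_{Λ₂ \ Λ₁}`. -/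
def splitConf (h : Λ₁ ≤ Λ₂) : Conf H Λ₂ ≃ Conf H Λ₁ × Conf H (Λ₂ \ Λ₁) where
  toFun σ := (fun x => σ ⟨x, h x.2⟩, fun x => σ ⟨x, (Finset.mem_sdiff.mp x.2).1⟩)
  invFun p x := if hx : x.1 ∈ Λ₁ then p.1 ⟨x, hx⟩
    else p.2 ⟨x, Finset.mem_sdiff.mpr ⟨x.2, hx⟩⟩
  left_inv σ := by
    funext x
    by_cases hx : x.1 ∈ Λ₁ <;> simp [hx]
  right_inv p := by
    refine Prod.ext (funext fun x => ?_) (funext fun x => ?_)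
    · simp
    · have hx := (Finset.mem_sdiff.mp x.2).2
      simp [hx]

open scoped Classical in
/-- The map `A ↦ A ⊗ 1` on matrices in the product bases. -/
def matrixInclusion (h : Λ₁ ≤ Λ₂) :
    Matrix (Conf H Λ₁) (Conf H Λ₁) ℂ →⋆ₐ[ℂ] Matrix (Conf H Λ₂) (Conf H Λ₂) ℂ where
  toFun A := (A ⊗ₖ (1 : Matrix (Conf H (Λ₂ \ Λ₁)) (Conf H (Λ₂ \ Λ₁)) ℂ)).submatrix
    (splitConf H h) (splitConf H h)
  map_one' := by rw [Matrix.one_kronecker_one, Matrix.submatrix_one_equiv]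
  map_mul' A B := by
    rw [Matrix.submatrix_mul_equiv, ← Matrix.mul_kronecker_mul, one_mul]
  map_zero' := by ext; simp
  map_add' A B := by rw [Matrix.add_kronecker, Matrix.submatrix_add]; rfl
  commutes' r := by
    rw [Algebra.algebraMap_eq_smul_one, Algebra.algebraMap_eq_smul_one, Matrix.smul_kronecker,
      Matrix.one_kronecker_one, ← Matrix.submatrix_one_equiv (splitConf H h)]
    rfl
  map_star' A := by
    rw [Matrix.star_eq_conjTranspose, Matrix.star_eq_conjTranspose, Matrix.conjTranspose_submatrix,
      Matrix.conjTranspose_kronecker, Matrix.conjTranspose_one]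

open scoped Classical in
theorem matrixInclusion_apply (h : Λ₁ ≤ Λ₂) (A : Matrix (Conf H Λ₁) (Conf H Λ₁) ℂ)
    (σ τ : Conf H Λ₂) : matrixInclusion H h A σ τ =
      if ∀ x : Λ₂, x.1 ∉ Λ₁ → σ x = τ x then A (splitConf H h σ).1 (splitConf H h τ).1 else 0 := by
  have h1 : (splitConf H h σ).2 = (splitConf H h τ).2 ↔ ∀ x : Λ₂, x.1 ∉ Λ₁ → σ x = τ x := by
    refine ⟨fun e x hx => congrFun e ⟨x, Finset.mem_sdiff.mpr ⟨x.2, hx⟩⟩, fun e => ?_⟩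
    funext x
    exact e _ (Finset.mem_sdiff.mp x.2).2
  change A _ _ * (1 : Matrix _ _ ℂ) _ _ = _
  rw [Matrix.one_apply, mul_ite, mul_one, mul_zero]
  exact if_congr h1 rfl rfl

/-- The natural inclusion `L(H_Λ₁) → L(H_Λ₂)`, `A ↦ A ⊗ 1`, for `Λ₁ ⊆ Λ₂`. -/
def inclusion (h : Λ₁ ≤ Λ₂) : LocalOp H Λ₁ →⋆ₐ[ℂ] LocalOp H Λ₂ :=
  ((LocalOp.ofMatrix H Λ₂ : _ →⋆ₐ[ℂ] LocalOp H Λ₂).comp (matrixInclusion H h)).comp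
    ((LocalOp.ofMatrix H Λ₁).symm : LocalOp H Λ₁ →⋆ₐ[ℂ] _)

theorem inclusion_apply (h : Λ₁ ≤ Λ₂) (A : LocalOp H Λ₁) :
    inclusion H h A =
      LocalOp.ofMatrix H Λ₂ (matrixInclusion H h ((LocalOp.ofMatrix H Λ₁).symm A)) := rfl

instance : DirectedSystem (LocalOp H) (fun _ _ h => inclusion H h) where
  map_self Λ A := by
    rw [inclusion_apply]
    have : ∀ M : Matrix (Conf H Λ) (Conf H Λ) ℂ, matrixInclusion H le_rfl M = M := by
      classical
      intro M
      ext σ τ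
      rw [matrixInclusion_apply, if_pos (fun x hx => absurd x.2 hx)]
      rfl
    rw [this, StarAlgEquiv.apply_symm_apply]
  map_map Λ₃ Λ₂ Λ₁ h₁₂ h₂₃ A := by
    classical
    simp only [inclusion_apply, StarAlgEquiv.symm_apply_apply]
    congr 1
    ext σ τ
    simp only [matrixInclusion_apply]
    rw [← ite_and]
    refine if_congr ⟨fun e x hx => ?_, fun e => ⟨fun x hx => ?_, fun x hx => ?_⟩⟩ rfl rfl
    · by_cases hx2 : x.1 ∈ Λ₂
      · exact e.2 ⟨x, hx2⟩ hx
      · exact e.1 x hx2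
    · exact e x fun hx1 => hx (h₁₂ hx1)
    · exact e _ hx

variable [∀ x, FiniteDimensional ℂ (H x)] [∀ x, Nontrivial (H x)]

instance (Λ : Finset S) : Nonempty (Conf H Λ) :=
  ⟨fun _ => ⟨0, Module.finrank_pos⟩⟩

theorem inclusion_injective (h : Λ₁ ≤ Λ₂) : Function.Injective (inclusion H h) := by
  classical
  refine (LocalOp.ofMatrix H Λ₂).injective.comp
    (Function.Injective.comp (fun A B hAB => ?_)
      (LocalOp.ofMatrix H Λ₁).symm.injective)
  ext σ τ
  obtain ⟨η⟩ : Nonempty (Conf H (Λ₂ \ Λ₁)) := inferInstance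
  have := congrFun (congrFun hAB ((splitConf H h).symm (σ, η))) ((splitConf H h).symm (τ, η))
  simpa [matrixInclusion] using this

theorem norm_inclusion (h : Λ₁ ≤ Λ₂) (A : LocalOp H Λ₁) : ‖inclusion H h A‖ = ‖A‖ :=
  NonUnitalStarAlgHom.norm_map (inclusion H h) (inclusion_injective H h) A

end Inclusion

/-! ### The local algebra `⋃_Λ L(H_Λ)` and its norm completion -/

section QuasiLocal

variable {S : Type u} (H : S → Type v) [∀ x, NormedAddCommGroup (H x)]
  [∀ x, InnerProductSpace ℂ (H x)]

/-- The algebra of local operators: the union (direct limit) of the algebras `L(H_Λ)` along the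
natural inclusions. The empty volume contributes only the multiples of the unit. -/
def LocalAlgebra : Type u := DirectLimit (LocalOp H) (fun _ _ h => inclusion H h)

namespace LocalAlgebra

instance : Ring (LocalAlgebra H) :=
  inferInstanceAs (Ring (DirectLimit (LocalOp H) (fun _ _ h => inclusion H h)))

instance : Algebra ℂ (LocalAlgebra H) :=
  inferInstanceAs (Algebra ℂ (DirectLimit (LocalOp H) (fun _ _ h => inclusion H h)))

instance : StarRing (LocalAlgebra H) :=
  inferInstanceAs (StarRing (DirectLimit (LocalOp H) (fun _ _ h => inclusion H h)))

instance : StarModule ℂ (LocalAlgebra H) :=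
  inferInstanceAs (StarModule ℂ (DirectLimit (LocalOp H) (fun _ _ h => inclusion H h)))

/-- The embedding of `L(H_Λ)` into the algebra of local operators. -/
def of (Λ : Finset S) : LocalOp H Λ →⋆ₐ[ℂ] LocalAlgebra H where
  toAlgHom := DirectLimit.Algebra.of (LocalOp H) (fun _ _ h => inclusion H h) Λ
  map_star' _ := rfl

theorem of_inclusion {Λ₁ Λ₂ : Finset S} (h : Λ₁ ≤ Λ₂) (A : LocalOp H Λ₁) :
    of H Λ₂ (inclusion H h A) = of H Λ₁ A :=
  DirectLimit.Algebra.of_f h A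

theorem exists_of (A : LocalAlgebra H) : ∃ Λ a, A = of H Λ a :=
  DirectLimit.exists_eq_mk _ A

theorem exists_of₂ (A B : LocalAlgebra H) : ∃ Λ a b, A = of H Λ a ∧ B = of H Λ b :=
  DirectLimit.exists_eq_mk₂ _ A B

variable [∀ x, FiniteDimensional ℂ (H x)] [∀ x, Nontrivial (H x)]

/-- The norm inherited from the operator norms on the algebras `L(H_Λ)`. -/
instance : Norm (LocalAlgebra H) where
  norm := DirectLimit.lift (fun _ _ h => inclusion H h) (fun _ A => ‖A‖)
    fun _ _ h A => (norm_inclusion H h A).symm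

theorem norm_of (Λ : Finset S) (A : LocalOp H Λ) : ‖of H Λ A‖ = ‖A‖ := rfl

instance : NormedRing (LocalAlgebra H) where
  __ := (inferInstance : Ring (LocalAlgebra H))
  __ := AddGroupNorm.toNormedAddCommGroup (E := LocalAlgebra H)
    { toFun := fun A => ‖A‖
      map_zero' := by rw [← map_zero (of H ∅), norm_of, norm_zero]
      add_le' := fun A B => by
        obtain ⟨Λ, a, b, rfl, rfl⟩ := exists_of₂ H A B
        rw [← map_add]
        exact norm_add_le a b
      neg' := fun A => by
        obtain ⟨Λ, a, rfl⟩ := exists_of H A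
        rw [← map_neg]
        exact norm_neg a
      eq_zero_of_map_eq_zero' := fun A hA => by
        obtain ⟨Λ, a, rfl⟩ := exists_of H A
        rw [norm_of, norm_eq_zero] at hA
        rw [hA, map_zero] }
  norm_mul_le A B := by
    obtain ⟨Λ, a, b, rfl, rfl⟩ := exists_of₂ H A B
    rw [← map_mul]
    exact norm_mul_le a b

instance : NormedAlgebra ℂ (LocalAlgebra H) where
  norm_smul_le r A := by
    obtain ⟨Λ, a, rfl⟩ := exists_of H A
    rw [← map_smul]
    exact norm_smul_le r a

instance : CStarRing (LocalAlgebra H) where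
  norm_mul_self_le A := by
    obtain ⟨Λ, a, rfl⟩ := exists_of H A
    rw [← map_star, ← map_mul]
    exact CStarRing.norm_mul_self_le a

end LocalAlgebra

variable [∀ x, FiniteDimensional ℂ (H x)] [∀ x, Nontrivial (H x)]

/-- The C⋆-algebra of quasi-local operators: the norm completion of the local algebra. -/
def QuasiLocal : Type u := UniformSpace.Completion (LocalAlgebra H)

namespace QuasiLocal

open UniformSpace

instance : NormedRing (QuasiLocal H) :=
  inferInstanceAs (NormedRing (Completion (LocalAlgebra H)))

instance : CompleteSpace (QuasiLocal H) :=
  inferInstanceAs (CompleteSpace (Completion (LocalAlgebra H)))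

instance : Algebra ℂ (QuasiLocal H) :=
  inferInstanceAs (Algebra ℂ (Completion (LocalAlgebra H)))

instance : NormedAlgebra ℂ (QuasiLocal H) where
  norm_smul_le r A := norm_smul_le (β := Completion (LocalAlgebra H)) r A

/-- The adjoint is extended from local operators by continuity. -/
instance : Star (QuasiLocal H) where
  star := Completion.map (star : LocalAlgebra H → LocalAlgebra H)

variable {H} in
/-- The embedding of the local algebra into its completion. -/
def coe (A : LocalAlgebra H) : QuasiLocal H := (A : Completion (LocalAlgebra H))

theorem uniformContinuous_star_local :
    UniformContinuous (star : LocalAlgebra H → LocalAlgebra H) :=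
  (AddMonoidHomClass.isometry_of_norm (starAddEquiv (R := LocalAlgebra H))
    norm_star).uniformContinuous

theorem star_coe (A : LocalAlgebra H) : star (coe A) = coe (star A) :=
  Completion.map_coe (uniformContinuous_star_local H) A

theorem continuous_star' : Continuous (star : QuasiLocal H → QuasiLocal H) :=
  Completion.continuous_map

theorem denseRange_coe : DenseRange (coe : LocalAlgebra H → QuasiLocal H) :=
  Completion.denseRange_coe

theorem coe_add (A B : LocalAlgebra H) : coe (A + B) = coe A + coe B :=
  Completion.coe_add A B

theorem coe_mul (A B : LocalAlgebra H) : coe (A * B) = coe A * coe B :=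
  Completion.coe_mul A B

theorem coe_smul (r : ℂ) (A : LocalAlgebra H) : coe (r • A) = r • coe A :=
  Completion.coe_smul r A

theorem norm_coe (A : LocalAlgebra H) : ‖coe A‖ = ‖A‖ :=
  Completion.norm_coe A

theorem continuous_coe : Continuous (coe : LocalAlgebra H → QuasiLocal H) :=
  Completion.continuous_coe _

instance : StarRing (QuasiLocal H) where
  star_involutive A := by
    refine (denseRange_coe H).induction_on A (isClosed_eq ?_ continuous_id) fun a => ?_
    · exact (continuous_star' H).comp (continuous_star' H)
    · rw [star_coe, star_coe, star_star]
  star_mul A B := by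
    refine (denseRange_coe H).induction_on₂ (p := fun A B => star (A * B) = star B * star A)
      (isClosed_eq ?_ ?_) (fun a b => ?_) A B
    · exact (continuous_star' H).comp continuous_mul
    · exact ((continuous_star' H).comp continuous_snd).mul
        ((continuous_star' H).comp continuous_fst)
    · rw [← coe_mul, star_coe, star_coe, star_coe, star_mul, coe_mul]
  star_add A B := by
    refine (denseRange_coe H).induction_on₂ (p := fun A B => star (A + B) = star A + star B)
      (isClosed_eq ?_ ?_) (fun a b => ?_) A B
    · exact (continuous_star' H).comp continuous_add
    · exact ((continuous_star' H).comp continuous_fst).add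
        ((continuous_star' H).comp continuous_snd)
    · rw [← coe_add, star_coe, star_coe, star_coe, star_add, coe_add]

instance : StarModule ℂ (QuasiLocal H) where
  star_smul r A := by
    refine (denseRange_coe H).induction_on A (isClosed_eq ?_ ?_) fun a => ?_
    · exact (continuous_star' H).comp (continuous_const_smul r)
    · exact (continuous_star' H).const_smul (star r)
    · rw [← coe_smul, star_coe, star_coe, star_smul, coe_smul]

instance : CStarRing (QuasiLocal H) where
  norm_mul_self_le A := by
    refine (denseRange_coe H).induction_on A (isClosed_le ?_ ?_) fun a => ?_
    · fun_prop
    · exact ((continuous_star' H).mul continuous_id).norm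
    · rw [star_coe, ← coe_mul, norm_coe, norm_coe]
      exact CStarRing.norm_mul_self_le a

instance : CStarAlgebra (QuasiLocal H) where
  __ := (inferInstance : NormedAlgebra ℂ (QuasiLocal H))
  __ := (inferInstance : StarModule ℂ (QuasiLocal H))

/-- The isometric embedding of `L(H_Λ)` into the quasi-local algebra. -/
def of (Λ : Finset S) : LocalOp H Λ →⋆ₐ[ℂ] QuasiLocal H where
  toFun A := coe (LocalAlgebra.of H Λ A)
  map_one' := by rw [map_one]; rfl
  map_mul' A B := by rw [map_mul, coe_mul]
  map_zero' := by rw [map_zero]; rfl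
  map_add' A B := by rw [map_add, coe_add]
  commutes' r := by rw [AlgHomClass.commutes]; rfl
  map_star' A := by rw [map_star, star_coe]

theorem norm_of (Λ : Finset S) (A : LocalOp H Λ) : ‖of H Λ A‖ = ‖A‖ := norm_coe H _

/-- The subalgebra `U_Λ` of the quasi-local algebra, for a finite set `Λ` of sites. -/
def localOps (Λ : Finset S) : StarSubalgebra ℂ (QuasiLocal H) := (of H Λ).range

variable {H} in
/-- The support of `A`: the smallest set of sites on which `A` is localised. -/
def supp (A : QuasiLocal H) : Set S := ⋂ Λ ∈ {Λ : Finset S | A ∈ localOps H Λ}, (Λ : Set S)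

end QuasiLocal

end QuasiLocal

/-! ### Interactions and infinite-volume dynamics -/

section Dynamics

/-- The finite nonempty sets of sites. -/
abbrev FiniteRegion (S : Type u) : Type u := {Λ : Finset S // Λ.Nonempty}

/-- All finite nonempty sets of sites contained in `Λ`. -/
def regionsIn {S : Type u} (Λ : Finset S) : Finset (FiniteRegion S) :=
  Λ.powerset.subtype Finset.Nonempty

variable {S : Type u} (H : S → Type v) [∀ x, NormedAddCommGroup (H x)]
  [∀ x, InnerProductSpace ℂ (H x)] [∀ x, FiniteDimensional ℂ (H x)] [∀ x, Nontrivial (H x)]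

/-- An interaction: a self-adjoint element of `U_Λ` for every finite nonempty set `Λ`. -/
structure Interaction where
  term : FiniteRegion S → QuasiLocal H
  term_mem : ∀ Λ, term Λ ∈ QuasiLocal.localOps H Λ.1
  isSelfAdjoint_term : ∀ Λ, IsSelfAdjoint (term Λ)

variable {H}

/-- The local Hamiltonian `∑_{X ⊆ Λ} φ(X)`. -/
def Interaction.hamiltonian (Φ : Interaction H) (Λ : Finset S) : QuasiLocal H :=
  ∑ X ∈ regionsIn Λ, Φ.term X

/-- The Heisenberg evolution `exp(itQ) A exp(-itQ)`. -/
def heisenberg (Q : QuasiLocal H) (t : ℝ) (A : QuasiLocal H) : QuasiLocal H :=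
  NormedSpace.exp ((Complex.I * t) • Q) * A * NormedSpace.exp (-((Complex.I * t) • Q))

/-- A strongly continuous one-parameter group of `*`-automorphisms of the quasi-local algebra. -/
structure IsAutomorphismGroup (α : ℝ → (QuasiLocal H ≃⋆ₐ[ℂ] QuasiLocal H)) : Prop where
  map_zero : ∀ A, α 0 A = A
  map_add : ∀ s t A, α (s + t) A = α s (α t A)
  continuous : ∀ A, Continuous fun t => α t A

/-- The interaction `Φ` induces the time evolution `α`: for every increasing sequence `Λ_m` of
finite sets of sites which exhausts the lattice, the local Heisenberg evolutions converge in norm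
to `α_t(A)`, uniformly for `t` in compact sets. -/
structure Interaction.Induces (Φ : Interaction H)
    (α : ℝ → (QuasiLocal H ≃⋆ₐ[ℂ] QuasiLocal H)) : Prop where
  isAutomorphismGroup : IsAutomorphismGroup α
  tendsto : ∀ Λ : ℕ → Finset S, Monotone Λ → (∀ x, ∃ m, x ∈ Λ m) →
    ∀ A : QuasiLocal H, ∀ K : Set ℝ, IsCompact K →
      TendstoUniformlyOn (fun m t => heisenberg (Φ.hamiltonian (Λ m)) t A) (fun t => α t A)
        Filter.atTop K

end Dynamics

/-! ### Multipole symmetries on subsets of Euclidean space -/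

section Multipole

variable {d : ℕ} (L : Set (EuclideanSpace ℝ (Fin d)))

/-- The countable set `L ⊆ ℝ^d` has effective dimension `γ > 0`: for some constants `C, r₀ ≥ 0`,
every open ball of radius `r ≥ r₀` around a point of `L` has at most `C r^γ` points of `L`. -/
structure HasEffectiveDimension (γ : ℝ) : Prop where
  countable : L.Countable
  pos : 0 < γ
  growth : ∃ C ≥ (0 : ℝ), ∃ r₀ ≥ (0 : ℝ), ∀ r ≥ r₀, ∀ z ∈ L,
    (Metric.ball z r ∩ L).Finite ∧ ((Metric.ball z r ∩ L).ncard : ℝ) ≤ C * r ^ γ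

variable {L} {H : L → Type v} [∀ x, NormedAddCommGroup (H x)]
  [∀ x, InnerProductSpace ℂ (H x)] [∀ x, FiniteDimensional ℂ (H x)] [∀ x, Nontrivial (H x)]

/-- A family of local charge operators. -/
structure IsChargeFamily (n : L → QuasiLocal H) : Prop where
  isLocal : ∀ x, ∃ Λ : Finset L, n x ∈ QuasiLocal.localOps H Λ
  isSelfAdjoint : ∀ x, IsSelfAdjoint (n x)
  commute : ∀ x y, Commute (n x) (n y)
  bounded : ∃ N₀ > (0 : ℝ), ∀ x, ‖n x‖ ≤ N₀
  finiteRange : ∃ R₀ > (0 : ℝ), ∀ x, (QuasiLocal.supp (n x)) ⊆ Metric.ball x R₀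

/-- The set of all sites `x` for which `supp(n_x)` meets `Λ`. -/
def chargesMeeting (n : L → QuasiLocal H) (Λ : Finset L) : Set L :=
  {x | (QuasiLocal.supp (n x) ∩ Λ).Nonempty}

/-- The multipole moment `∑ x^a n_x`, over all sites `x` for which `supp(n_x)` meets `Λ`. -/
def multipoleMoment (n : L → QuasiLocal H) (a : Fin d → ℕ) (Λ : Finset L) : QuasiLocal H :=
  ∑ᶠ x ∈ chargesMeeting n Λ, ((∏ j, (x : EuclideanSpace ℝ (Fin d)) j ^ a j : ℝ) : ℂ) • n x

/-- For `A ∈ U_Λ`, the operator `exp(-is ∑ x^a n_x) A exp(is ∑ x^a n_x)`, where the sums are over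
all sites `x` for which `supp(n_x)` meets `Λ`. -/
def localMultipole (n : L → QuasiLocal H) (a : Fin d → ℕ) (s : ℝ) (Λ : Finset L)
    (A : QuasiLocal H) : QuasiLocal H :=
  heisenberg (multipoleMoment n a Λ) (-s) A

/-- `τ` is the multipole group of order `a`: the strongly continuous one-parameter group of
`*`-automorphisms which acts on local operators by `localMultipole`. -/
structure IsMultipoleGroup (n : L → QuasiLocal H) (a : Fin d → ℕ)
    (τ : ℝ → (QuasiLocal H ≃⋆ₐ[ℂ] QuasiLocal H)) : Prop where
  isAutomorphismGroup : IsAutomorphismGroup τ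
  apply_local : ∀ (s : ℝ) (Λ : Finset L), ∀ A ∈ QuasiLocal.localOps H Λ,
    τ s A = localMultipole n a s Λ A

/-- The interaction `Φ` is `k`-symmetric with respect to the charges `n`, on a lattice of effective
dimension `γ`: all its terms are invariant under all multipole groups of order at most `k`, and
it satisfies the two decay conditions. -/
structure Interaction.IsSymmetric (Φ : Interaction H) (n : L → QuasiLocal H) (γ : ℝ) (k : ℕ) :
    Prop where
  invariant : ∀ a : Fin d → ℕ, ∑ j, a j ≤ k → ∀ (Λ : FiniteRegion L) (s : ℝ),
    localMultipole n a s Λ.1 (Φ.term Λ) = Φ.term Λ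
  decay : (⨆ x : L, ∑' Λ : {Λ : FiniteRegion L // x ∈ Λ.1}, ‖Φ.term Λ.1‖ₑ *
    (∑' z : chargesMeeting n Λ.1.1, ENNReal.ofReal (dist z.1 x ^ (k + 1))) ^ 2) < ⊤
  decay' : ∃ ε > (0 : ℝ), (⨆ (x : L) (y : L), ENNReal.ofReal ((1 + dist x y) ^ (γ + 1 + ε)) *
    ∑' Λ : {Λ : FiniteRegion L // x ∈ Λ.1 ∧ y ∈ Λ.1}, ‖Φ.term Λ.1‖ₑ) < ⊤

end Multipole

end QuantumLattice

end

/-! The time evolution is a limit of finite-volume evolutions. Write `P`, `Q` for the Hamiltonians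
of two volumes; then `P_t(Q_{-t}(B)) - B` has a derivative which sees only `P - Q`. For a local `B`,
convergence thus reduces to showing that terms far from `B` almost commute with its evolution,
uniformly in the volume. This is the Lieb-Robinson bound `lieb_robinson`. It is proved by iterating
a one-step commutator estimate: a weight `F` with `F * F ≤ C F` under convolution lets the iteration
close, and the volume-dependent remainder dies factorially. The decay condition with exponent `γ + 1
+ ε` and the growth of the lattice supply the weight `(1 + |x - y|)^(-(γ + 1 + ε))`.

The multipole groups need no estimate. Charges commute with each other, and a charge whose support
misses `Λ` commutes with `U_Λ`, so on `U_Λ` the evolutions generated by larger volumes all coincide.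
This needs local operators to be localised on their support, which is shown on matrix entries.

Both limits pass through `exists_isAutomorphismGroup`: Heisenberg evolutions are isometric, so
convergence on local operators gives a strongly continuous group. Finally `τ_s` fixes every
interaction term, hence every local Hamiltonian, hence commutes with every local evolution and with
their limit. -/

noncomputable section

namespace QuantumLattice

universe u v

open Filter Topology

/-! ### Localisation of operators: intersections, disjoint volumes, supports -/

section LocalStructure

variable {S : Type u} (H : S → Type v) [∀ x, NormedAddCommGroup (H x)]
  [∀ x, InnerProductSpace ℂ (H x)]

/-- Two labels which agree at every site outside `X`. -/
def AgreeOff {Λ : Finset S} (X : Finset S) (σ τ : Conf H Λ) : Prop :=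
  ∀ x : Λ, x.1 ∉ X → σ x = τ x

/-- Two labels which agree at every site of `X`. -/
def AgreeOn {Λ : Finset S} (X : Finset S) (σ τ : Conf H Λ) : Prop :=
  ∀ x : Λ, x.1 ∈ X → σ x = τ x

open scoped Classical in
/-- The label which is `σ` on `X` and `τ` elsewhere. -/
def glue {Λ : Finset S} (X : Finset S) (σ τ : Conf H Λ) : Conf H Λ :=
  fun x => if x.1 ∈ X then σ x else τ x

variable {H}

theorem agreeOn_glue {Λ : Finset S} (X : Finset S) (σ τ : Conf H Λ) :
    AgreeOn H X (glue H X σ τ) σ := fun _ hx => if_pos hx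

theorem agreeOff_glue {Λ : Finset S} (X : Finset S) (σ τ : Conf H Λ) :
    AgreeOff H X (glue H X σ τ) τ := fun _ hx => if_neg hx

/-- A matrix of the form `M ⊗ 1` with `M` acting on the sites in `X`. -/
structure IsMatrixOn {Λ : Finset S} (X : Finset S) (M : Matrix (Conf H Λ) (Conf H Λ) ℂ) :
    Prop where
  eq_zero : ∀ σ τ, ¬ AgreeOff H X σ τ → M σ τ = 0
  congr : ∀ σ τ σ' τ', AgreeOff H X σ τ → AgreeOff H X σ' τ' → AgreeOn H X σ σ' →
    AgreeOn H X τ τ' → M σ τ = M σ' τ'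

theorem isMatrixOn_matrixInclusion {X Λ : Finset S} (h : X ≤ Λ)
    (M : Matrix (Conf H X) (Conf H X) ℂ) : IsMatrixOn X (matrixInclusion H h M) where
  eq_zero σ τ hn := (matrixInclusion_apply H h M σ τ).trans (if_neg hn)
  congr σ τ σ' τ' h1 h2 h3 h4 := by
    have e1 : (splitConf H h σ).1 = (splitConf H h σ').1 := funext fun x => h3 _ x.2
    have e2 : (splitConf H h τ).1 = (splitConf H h τ').1 := funext fun x => h4 _ x.2
    refine ((matrixInclusion_apply H h M σ τ).trans (if_pos h1)).trans
      (Eq.trans ?_ ((matrixInclusion_apply H h M σ' τ').trans (if_pos h2)).symm)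
    rw [e1, e2]

/-- Labels are changed in two moves: locality on `X` allows a change off `X`, after which only sites
of `X` outside `Y` still differ, and locality on `Y` allows changing those. -/
theorem IsMatrixOn.inter {Λ X Y : Finset S} [DecidableEq S]
    {M : Matrix (Conf H Λ) (Conf H Λ) ℂ}
    (hX : IsMatrixOn X M) (hY : IsMatrixOn Y M) : IsMatrixOn (X ∩ Y) M where
  eq_zero σ τ hn := by
    by_cases h : AgreeOff H X σ τ
    · refine hY.eq_zero σ τ fun h' => hn fun x hx => ?_
      by_cases hxX : x.1 ∈ X
      · exact h' x fun hxY => hx (Finset.mem_inter.mpr ⟨hxX, hxY⟩)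
      · exact h x hxX
    · exact hX.eq_zero σ τ h
  congr σ τ σ' τ' h1 h2 h3 h4 := by
    have hsub : ∀ x : Λ, x.1 ∉ X → x.1 ∉ X ∩ Y := fun x hx hx' =>
      hx (Finset.mem_inter.mp hx').1
    have hsub' : ∀ x : Λ, x.1 ∉ Y → x.1 ∉ X ∩ Y := fun x hx hx' =>
      hx (Finset.mem_inter.mp hx').2
    rw [hX.congr σ τ (glue H X σ σ') (glue H X τ τ') (fun x hx => h1 x (hsub x hx))
      (fun x hx => ?_) (fun x hx => (agreeOn_glue X σ σ' x hx).symm)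
      (fun x hx => (agreeOn_glue X τ τ' x hx).symm)]
    · refine hY.congr _ _ _ _ (fun x hx => ?_) (fun x hx => h2 x (hsub' x hx))
        (fun x hx => ?_) (fun x hx => ?_)
      · by_cases hxX : x.1 ∈ X
        · rw [agreeOn_glue X σ σ' x hxX, agreeOn_glue X τ τ' x hxX, h1 x (hsub' x hx)]
        · rw [agreeOff_glue X σ σ' x hxX, agreeOff_glue X τ τ' x hxX, h2 x (hsub' x hx)]
      · by_cases hxX : x.1 ∈ X
        · rw [agreeOn_glue X σ σ' x hxX, h3 x (Finset.mem_inter.mpr ⟨hxX, hx⟩)]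
        · rw [agreeOff_glue X σ σ' x hxX]
      · by_cases hxX : x.1 ∈ X
        · rw [agreeOn_glue X τ τ' x hxX, h4 x (Finset.mem_inter.mpr ⟨hxX, hx⟩)]
        · rw [agreeOff_glue X τ τ' x hxX]
    · rw [agreeOff_glue X σ σ' x hx, agreeOff_glue X τ τ' x hx, h2 x (hsub x hx)]

/-- Only one intermediate label contributes: it must equal `σ` off `X` and `τ` off `Y`, hence `τ` on
`X`. -/
theorem IsMatrixOn.mul_apply {Λ X Y : Finset S} (hXY : Disjoint X Y)
    {M N : Matrix (Conf H Λ) (Conf H Λ) ℂ} (hM : IsMatrixOn X M) (hN : IsMatrixOn Y N)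
    (σ τ : Conf H Λ) : (M * N) σ τ = M σ (glue H X τ σ) * N (glue H X τ σ) τ := by
  rw [Matrix.mul_apply]
  refine Finset.sum_eq_single _ (fun ρ _ hρ => ?_) fun h => absurd (Finset.mem_univ _) h
  by_cases h1 : AgreeOff H X σ ρ
  · by_cases h2 : AgreeOff H Y ρ τ
    · refine absurd (funext fun x => ?_) hρ
      by_cases hx : x.1 ∈ X
      · rw [agreeOn_glue X τ σ x hx, h2 x (Finset.disjoint_left.mp hXY hx)]
      · rw [agreeOff_glue X τ σ x hx, h1 x hx]
    · rw [hN.eq_zero _ _ h2, mul_zero]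
  · rw [hM.eq_zero _ _ h1, zero_mul]

theorem IsMatrixOn.commute {Λ X Y : Finset S} (hXY : Disjoint X Y)
    {M N : Matrix (Conf H Λ) (Conf H Λ) ℂ} (hM : IsMatrixOn X M) (hN : IsMatrixOn Y N) :
    Commute M N := by
  classical
  ext σ τ
  rw [hM.mul_apply hXY hN, hN.mul_apply hXY.symm hM]
  -- If the labels agree off `X ∪ Y`, the single surviving terms of `M * N` and `N * M` have the
  -- same two factors; otherwise both terms vanish.
  by_cases h : AgreeOff H (X ∪ Y) σ τ
  · rw [mul_comm]
    have key : ∀ {X Y : Finset S}, Disjoint X Y → AgreeOff H (X ∪ Y) σ τ →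
        ∀ {N : Matrix (Conf H Λ) (Conf H Λ) ℂ}, IsMatrixOn Y N →
        N (glue H X τ σ) τ = N σ (glue H Y τ σ) := by
      intro X Y hXY h N hN
      refine hN.congr _ _ _ _ (fun x hx => ?_) (fun x hx => (agreeOff_glue Y τ σ x hx).symm)
        (fun x hx => agreeOff_glue X τ σ x (Finset.disjoint_right.mp hXY hx))
        (fun x hx => (agreeOn_glue Y τ σ x hx).symm)
      by_cases hxX : x.1 ∈ X
      · exact agreeOn_glue X τ σ x hxX
      · rw [agreeOff_glue X τ σ x hxX]
        exact h x (by simp [hx, hxX])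
    rw [key hXY h hN, key hXY.symm (by rwa [Finset.union_comm]) hM]
  · have key : ∀ {X Y : Finset S}, ¬ AgreeOff H (X ∪ Y) σ τ →
        ∀ {N : Matrix (Conf H Λ) (Conf H Λ) ℂ}, IsMatrixOn Y N →
        N (glue H X τ σ) τ = 0 := by
      intro X Y h N hN
      refine hN.eq_zero _ _ fun h' => h fun x hx => ?_
      rw [Finset.mem_union, not_or] at hx
      rw [← h' x hx.2, agreeOff_glue X τ σ x hx.1]
    rw [key h hN, key (by rwa [Finset.union_comm]) hM, mul_zero, mul_zero]

variable [∀ x, FiniteDimensional ℂ (H x)] [∀ x, Nontrivial (H x)]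

/-- The small matrix is read off after filling the sites outside `X` with an arbitrary reference
label `η`; locality makes the choice immaterial. -/
theorem IsMatrixOn.exists_eq {Λ X : Finset S} (h : X ≤ Λ)
    {M : Matrix (Conf H Λ) (Conf H Λ) ℂ} (hM : IsMatrixOn X M) :
    ∃ N, matrixInclusion H h N = M := by
  classical
  obtain ⟨η⟩ : Nonempty (Conf H Λ) := inferInstance
  let ext : Conf H X → Conf H Λ := fun σ x => if hx : x.1 ∈ X then σ ⟨x, hx⟩ else η x
  refine ⟨Matrix.of fun σ τ => M (ext σ) (ext τ), ?_⟩
  ext σ τ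
  by_cases hστ : AgreeOff H X σ τ
  · refine ((matrixInclusion_apply H h _ σ τ).trans (if_pos hστ)).trans ?_
    refine hM.congr _ _ _ _ (fun x hx => ?_) hστ (fun x hx => ?_) (fun x hx => ?_)
    · simp [ext, hx]
    · exact dif_pos hx
    · exact dif_pos hx
  · exact ((matrixInclusion_apply H h _ σ τ).trans (if_neg hστ)).trans (hM.eq_zero _ _ hστ).symm

namespace QuasiLocal

theorem of_inclusion {X Λ : Finset S} (h : X ≤ Λ) (A : LocalOp H X) :
    of H Λ (inclusion H h A) = of H X A :=
  congrArg coe (LocalAlgebra.of_inclusion H h A)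

theorem localOps_mono {X Λ : Finset S} (h : X ≤ Λ) : localOps H X ≤ localOps H Λ := by
  rintro _ ⟨A, rfl⟩
  exact ⟨inclusion H h A, of_inclusion h A⟩

theorem of_injective (Λ : Finset S) : Function.Injective (of H Λ) := by
  refine (injective_iff_map_eq_zero _).mpr fun A hA => ?_
  rw [← norm_eq_zero, ← norm_of H Λ A, hA, norm_zero]

/-- Turns membership in `U_X` into a condition on entries in one larger volume, where operators from
several regions can be compared. -/
theorem mem_localOps_iff {X Λ : Finset S} (h : X ≤ Λ)
    (M : Matrix (Conf H Λ) (Conf H Λ) ℂ) :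
    of H Λ (LocalOp.ofMatrix H Λ M) ∈ localOps H X ↔ IsMatrixOn X M := by
  constructor
  · rintro ⟨A, hA⟩
    have hA' : of H X A = of H Λ (LocalOp.ofMatrix H Λ M) := hA
    rw [← of_inclusion h, inclusion_apply] at hA'
    rw [← (LocalOp.ofMatrix H Λ).injective (of_injective Λ hA')]
    exact isMatrixOn_matrixInclusion h _
  · intro hM
    obtain ⟨N, rfl⟩ := hM.exists_eq h
    refine ⟨LocalOp.ofMatrix H X N, ?_⟩
    change of H X (LocalOp.ofMatrix H X N) = _
    rw [← of_inclusion h, inclusion_apply, StarAlgEquiv.symm_apply_apply]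

theorem exists_matrix {Λ : Finset S} {A : QuasiLocal H} (hA : A ∈ localOps H Λ) :
    ∃ M, A = of H Λ (LocalOp.ofMatrix H Λ M) := by
  obtain ⟨a, rfl⟩ := hA
  exact ⟨(LocalOp.ofMatrix H Λ).symm a, by rw [StarAlgEquiv.apply_symm_apply]; rfl⟩

/-- This is why the support, defined as an intersection of volumes, is itself a volume on which the
operator lives. -/
theorem mem_localOps_inter [DecidableEq S] {X Y : Finset S} {A : QuasiLocal H}
    (hX : A ∈ localOps H X) (hY : A ∈ localOps H Y) : A ∈ localOps H (X ∩ Y) := by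
  have h1 : X ≤ X ∪ Y := Finset.subset_union_left
  have h2 : Y ≤ X ∪ Y := Finset.subset_union_right
  obtain ⟨M, rfl⟩ := exists_matrix (localOps_mono h1 hX)
  rw [mem_localOps_iff h1] at hX
  rw [mem_localOps_iff h2] at hY
  rw [mem_localOps_iff (Finset.inter_subset_left.trans h1)]
  exact hX.inter hY

/-- Operators localised in disjoint regions commute. -/
theorem commute_of_disjoint {X Y : Finset S} (hXY : Disjoint X Y) {A B : QuasiLocal H}
    (hA : A ∈ localOps H X) (hB : B ∈ localOps H Y) : Commute A B := by
  classical
  have h1 : X ≤ X ∪ Y := Finset.subset_union_left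
  have h2 : Y ≤ X ∪ Y := Finset.subset_union_right
  obtain ⟨M, rfl⟩ := exists_matrix (localOps_mono h1 hA)
  obtain ⟨N, rfl⟩ := exists_matrix (localOps_mono h2 hB)
  rw [mem_localOps_iff h1] at hA
  rw [mem_localOps_iff h2] at hB
  exact ((hA.commute hXY hB).map (LocalOp.ofMatrix H (X ∪ Y))).map (of H (X ∪ Y))

/-- A local operator is localised on its support. -/
theorem exists_mem_localOps_supp {A : QuasiLocal H} (hA : ∃ Λ : Finset S, A ∈ localOps H Λ) :
    ∃ Λ : Finset S, A ∈ localOps H Λ ∧ (Λ : Set S) = supp A := by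
  classical
  -- A minimal volume is the least one, since intersecting it with any other volume of `A` cannot
  -- shrink it.
  obtain ⟨Λ, hΛ, hmin⟩ := exists_minimal_of_wellFoundedLT (fun Λ => A ∈ localOps H Λ) hA
  refine ⟨Λ, hΛ, subset_antisymm ?_ ?_⟩
  · refine Set.subset_iInter₂ fun Λ' hΛ' => ?_
    have := hmin (mem_localOps_inter hΛ hΛ') Finset.inter_subset_left
    exact Finset.coe_subset.mpr (this.trans Finset.inter_subset_right)
  · exact Set.iInter₂_subset Λ hΛ

theorem commute_of_supp_disjoint {A B : QuasiLocal H} {X : Finset S}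
    (hA : ∃ Λ : Finset S, A ∈ localOps H Λ) (hAX : ¬ (supp A ∩ X).Nonempty)
    (hB : B ∈ localOps H X) : Commute A B := by
  obtain ⟨Λ, hΛ, hs⟩ := exists_mem_localOps_supp hA
  refine commute_of_disjoint ?_ hΛ hB
  rw [← Finset.disjoint_coe, hs, Set.disjoint_iff_inter_eq_empty]
  exact Set.not_nonempty_iff_eq_empty.mp hAX

/-- The local operators are dense. -/
theorem induction_on_localOps {p : QuasiLocal H → Prop} (hp : IsClosed {A | p A})
    (h : ∀ Λ, ∀ A ∈ localOps H Λ, p A) (A : QuasiLocal H) : p A := by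
  refine (denseRange_coe H).induction_on A hp fun a => ?_
  obtain ⟨Λ, b, rfl⟩ := LocalAlgebra.exists_of H a
  exact h Λ _ ⟨b, rfl⟩

end QuasiLocal

end LocalStructure

/-! ### Algebra and calculus of Heisenberg evolutions -/

section Heisenberg

variable {S : Type u} {H : S → Type v} [∀ x, NormedAddCommGroup (H x)]
  [∀ x, InnerProductSpace ℂ (H x)] [∀ x, FiniteDimensional ℂ (H x)] [∀ x, Nontrivial (H x)]

instance : NormedAlgebra ℚ (QuasiLocal H) := NormedAlgebra.restrictScalars ℚ ℂ (QuasiLocal H)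

/-- The commutator with a self-adjoint element, multiplied by the imaginary unit. -/
def derivation (Q A : QuasiLocal H) : QuasiLocal H := Complex.I • (Q * A - A * Q)

theorem norm_derivation (Q A : QuasiLocal H) : ‖derivation Q A‖ = ‖Q * A - A * Q‖ := by
  rw [derivation, norm_smul, Complex.norm_I, one_mul]

theorem hasDerivAt_expI (Q : QuasiLocal H) (t : ℝ) :
    HasDerivAt (fun s : ℝ => NormedSpace.exp ((Complex.I * s) • Q))
      (NormedSpace.exp ((Complex.I * t) • Q) * (Complex.I • Q)) t := by
  have h := hasDerivAt_exp_smul_const (𝕂 := ℝ) (Complex.I • Q) t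
  have e : ∀ s : ℝ, s • Complex.I • Q = (Complex.I * s) • Q := fun s => by
    rw [mul_comm, mul_smul, Complex.coe_smul]
  simpa only [e] using h

theorem exp_neg_eq (Q : QuasiLocal H) (t : ℝ) :
    NormedSpace.exp (-((Complex.I * t) • Q)) = NormedSpace.exp ((Complex.I * (-t : ℝ)) • Q) := by
  rw [Complex.ofReal_neg, mul_neg, neg_smul]

theorem expI_add (Q : QuasiLocal H) (s t : ℝ) :
    NormedSpace.exp ((Complex.I * (s + t : ℝ)) • Q) =
      NormedSpace.exp ((Complex.I * s) • Q) * NormedSpace.exp ((Complex.I * t) • Q) := by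
  rw [Complex.ofReal_add, mul_add, add_smul, NormedSpace.exp_add_of_commute]
  exact ((Commute.refl Q).smul_left _).smul_right _

theorem heisenberg_eq (Q : QuasiLocal H) (t : ℝ) (A : QuasiLocal H) :
    heisenberg Q t A = NormedSpace.exp ((Complex.I * t) • Q) * A *
      NormedSpace.exp ((Complex.I * (-t : ℝ)) • Q) := by
  rw [heisenberg, exp_neg_eq]

theorem heisenberg_zero_left (Q A : QuasiLocal H) : heisenberg Q 0 A = A := by
  simp [heisenberg]

theorem heisenberg_add_left (Q : QuasiLocal H) (s t : ℝ) (A : QuasiLocal H) :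
    heisenberg Q (s + t) A = heisenberg Q s (heisenberg Q t A) := by
  simp only [heisenberg_eq]
  rw [expI_add, neg_add_rev, expI_add]
  simp only [mul_assoc]

theorem heisenberg_heisenberg_neg (Q : QuasiLocal H) (t : ℝ) (A : QuasiLocal H) :
    heisenberg Q t (heisenberg Q (-t) A) = A := by
  rw [← heisenberg_add_left, add_neg_cancel, heisenberg_zero_left]

theorem heisenberg_neg (Q : QuasiLocal H) (t : ℝ) (A : QuasiLocal H) :
    heisenberg (-Q) t A = heisenberg Q (-t) A := by
  simp [heisenberg]

theorem heisenberg_add (Q : QuasiLocal H) (t : ℝ) (A B : QuasiLocal H) :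
    heisenberg Q t (A + B) = heisenberg Q t A + heisenberg Q t B := by
  simp only [heisenberg, mul_add, add_mul]

theorem heisenberg_sub (Q : QuasiLocal H) (t : ℝ) (A B : QuasiLocal H) :
    heisenberg Q t (A - B) = heisenberg Q t A - heisenberg Q t B := by
  simp only [heisenberg, mul_sub, sub_mul]

theorem heisenberg_smul (Q : QuasiLocal H) (t : ℝ) (c : ℂ) (A : QuasiLocal H) :
    heisenberg Q t (c • A) = c • heisenberg Q t A := by
  simp only [heisenberg, mul_smul_comm, smul_mul_assoc]

theorem heisenberg_mul (Q : QuasiLocal H) (t : ℝ) (A B : QuasiLocal H) :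
    heisenberg Q t (A * B) = heisenberg Q t A * heisenberg Q t B := by
  have h : NormedSpace.exp ((Complex.I * (-t : ℝ)) • Q) *
      NormedSpace.exp ((Complex.I * t) • Q) = 1 := by
    rw [← expI_add, neg_add_cancel]
    simp
  simp only [heisenberg_eq]
  calc _ = NormedSpace.exp ((Complex.I * t) • Q) * A * 1 * B *
        NormedSpace.exp ((Complex.I * (-t : ℝ)) • Q) := by simp only [mul_assoc, mul_one]
    _ = _ := by rw [← h]; simp only [mul_assoc]

theorem star_expI {Q : QuasiLocal H} (hQ : IsSelfAdjoint Q) (t : ℝ) :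
    star (NormedSpace.exp ((Complex.I * t) • Q)) =
      NormedSpace.exp ((Complex.I * (-t : ℝ)) • Q) := by
  rw [NormedSpace.star_exp, star_smul, hQ.star_eq]
  simp

theorem heisenberg_star {Q : QuasiLocal H} (hQ : IsSelfAdjoint Q) (t : ℝ) (A : QuasiLocal H) :
    heisenberg Q t (star A) = star (heisenberg Q t A) := by
  simp only [heisenberg_eq, star_mul, star_expI hQ, neg_neg, mul_assoc]

theorem expI_mem_unitary {Q : QuasiLocal H} (hQ : IsSelfAdjoint Q) (t : ℝ) :
    NormedSpace.exp ((Complex.I * t) • Q) ∈ unitary (QuasiLocal H) := by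
  rw [Unitary.mem_iff, star_expI hQ, ← expI_add, ← expI_add]
  simp

theorem norm_heisenberg {Q : QuasiLocal H} (hQ : IsSelfAdjoint Q) (t : ℝ) (A : QuasiLocal H) :
    ‖heisenberg Q t A‖ = ‖A‖ := by
  rw [heisenberg_eq, CStarRing.norm_mul_mem_unitary _ (expI_mem_unitary hQ _),
    CStarRing.norm_mem_unitary_mul _ (expI_mem_unitary hQ _)]

theorem heisenberg_of_commute {Q A : QuasiLocal H} (h : Commute Q A) (t : ℝ) :
    heisenberg Q t A = A := by
  have h1 : Commute (NormedSpace.exp ((Complex.I * t) • Q)) A := (h.smul_left _).exp_left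
  rw [heisenberg_eq, h1.eq, mul_assoc, ← expI_add]
  simp

/-- The exponentials factor, and the two `Q`-factors placed next to `A` cancel. -/
theorem heisenberg_add_of_commute {P Q A : QuasiLocal H} (hPQ : Commute P Q) (h : Commute Q A)
    (t : ℝ) : heisenberg (P + Q) t A = heisenberg P t A := by
  have e : ∀ c : ℂ, NormedSpace.exp (c • (P + Q)) =
      NormedSpace.exp (c • P) * NormedSpace.exp (c • Q) := fun c => by
    rw [smul_add, NormedSpace.exp_add_of_commute ((hPQ.smul_left _).smul_right _)]
  have e' : ∀ c : ℂ, NormedSpace.exp (c • (P + Q)) =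
      NormedSpace.exp (c • Q) * NormedSpace.exp (c • P) := fun c => by
    rw [add_comm, smul_add, NormedSpace.exp_add_of_commute ((hPQ.symm.smul_left _).smul_right _)]
  conv_rhs => rw [← heisenberg_of_commute h t]
  simp only [heisenberg_eq]
  rw [e, e']
  simp only [mul_assoc]

theorem hasDerivAt_heisenberg (Q : QuasiLocal H) {f : ℝ → QuasiLocal H} {f' : QuasiLocal H}
    {t : ℝ} (hf : HasDerivAt f f' t) :
    HasDerivAt (fun s => heisenberg Q s (f s)) (heisenberg Q t (derivation Q (f t) + f')) t := by
  have h1 := hasDerivAt_expI Q t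
  have h2 : HasDerivAt (fun s : ℝ => NormedSpace.exp ((Complex.I * (-s : ℝ)) • Q))
      (-(Complex.I • Q * NormedSpace.exp ((Complex.I * (-t : ℝ)) • Q))) t := by
    refine ((hasDerivAt_expI Q (-t)).scomp t (hasDerivAt_neg t)).congr_deriv ?_
    rw [neg_one_smul]
    exact congrArg _ (((Commute.refl Q).smul_left Complex.I).smul_right
      (Complex.I * ((-t : ℝ) : ℂ))).exp_right.eq.symm
  have e : (fun s => heisenberg Q s (f s)) = fun s : ℝ => NormedSpace.exp ((Complex.I * s) • Q) *
      f s * NormedSpace.exp ((Complex.I * (-s : ℝ)) • Q) := funext fun s => heisenberg_eq Q s _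
  rw [e]
  refine ((h1.mul hf).mul h2).congr_deriv ?_
  rw [heisenberg_eq, derivation]
  simp only [Pi.mul_apply, mul_add, add_mul, mul_sub, sub_mul, smul_sub, smul_mul_assoc,
    mul_smul_comm, mul_assoc, mul_neg]
  abel

theorem hasDerivAt_heisenberg_const (Q A : QuasiLocal H) (t : ℝ) :
    HasDerivAt (fun s => heisenberg Q s A) (heisenberg Q t (derivation Q A)) t := by
  simpa using hasDerivAt_heisenberg Q (hasDerivAt_const t A)

theorem heisenberg_derivation (Q A : QuasiLocal H) (t : ℝ) :
    heisenberg Q t (derivation Q A) = derivation Q (heisenberg Q t A) := by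
  simp only [derivation, heisenberg_smul, heisenberg_sub, heisenberg_mul,
    heisenberg_of_commute (Commute.refl Q)]

theorem derivation_sub (P Q A : QuasiLocal H) :
    derivation (P - Q) A = derivation P A - derivation Q A := by
  simp only [derivation, sub_mul, mul_sub, smul_sub]
  abel

theorem continuous_heisenberg (Q A : QuasiLocal H) : Continuous fun t => heisenberg Q t A :=
  continuous_iff_continuousAt.mpr fun t => (hasDerivAt_heisenberg_const Q A t).continuousAt

/-- Interaction picture: the part common to both generators drops out, leaving only `P - Q`. -/
theorem hasDerivAt_heisenberg_heisenberg_neg (P Q B : QuasiLocal H) (t : ℝ) :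
    HasDerivAt (fun s => heisenberg P s (heisenberg Q (-s) B))
      (heisenberg P t (derivation (P - Q) (heisenberg Q (-t) B))) t := by
  have h := (hasDerivAt_heisenberg_const Q B (-t)).scomp t (hasDerivAt_neg t)
  refine (hasDerivAt_heisenberg P h).congr_deriv ?_
  rw [Function.comp_apply, derivation_sub, heisenberg_derivation, neg_one_smul, sub_eq_add_neg]

/-- Duhamel's comparison of two evolutions. -/
theorem norm_heisenberg_heisenberg_neg_sub_le {P Q : QuasiLocal H} (hP : IsSelfAdjoint P)
    (B : QuasiLocal H) {T : ℝ} {β β' : ℝ → ℝ} (hβ : ∀ s, HasDerivAt β (β' s) s) (h0 : 0 ≤ β 0)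
    (hle : ∀ s ∈ Set.Ico 0 T, ‖derivation (P - Q) (heisenberg Q (-s) B)‖ ≤ β' s) {t : ℝ}
    (ht : t ∈ Set.Icc 0 T) : ‖heisenberg P t (heisenberg Q (-t) B) - B‖ ≤ β t := by
  have hd := fun s => (hasDerivAt_heisenberg_heisenberg_neg P Q B s).sub_const B
  refine image_norm_le_of_norm_deriv_right_le_deriv_boundary
    (f := fun s => heisenberg P s (heisenberg Q (-s) B) - B)
    (fun s _ => (hd s).continuousAt.continuousWithinAt) (fun s _ => (hd s).hasDerivWithinAt)
    (by simpa [heisenberg_zero_left] using h0) hβ (fun s hs => ?_) ht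
  -- The outer evolution is isometric, so only the inner derivation has to be bounded.
  rw [norm_heisenberg hP]
  exact hle s hs

/-- In particular, an automorphism that fixes the generator commutes with the evolution. -/
theorem map_heisenberg (f : QuasiLocal H ≃⋆ₐ[ℂ] QuasiLocal H) (hf : Continuous f)
    (Q : QuasiLocal H) (t : ℝ) (A : QuasiLocal H) :
    f (heisenberg Q t A) = heisenberg (f Q) t (f A) := by
  simp only [heisenberg, map_mul, NormedSpace.map_exp f hf, map_neg, map_smul]

end Heisenberg

/-! ### Limits of Heisenberg evolutions -/

section LimitGroup

variable {S : Type u} {H : S → Type v} [∀ x, NormedAddCommGroup (H x)]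
  [∀ x, InnerProductSpace ℂ (H x)] [∀ x, FiniteDimensional ℂ (H x)] [∀ x, Nontrivial (H x)]
  {ι : Type*} {l : Filter ι} {Q : ι → QuasiLocal H}

/-- Each evolution is isometric, so an `ε/3` argument shows that the operators with this property
form a closed set; local operators are dense. -/
theorem uniformCauchySeqOn_heisenberg (hQ : ∀ i, IsSelfAdjoint (Q i)) {K : Set ℝ}
    (hc : ∀ Λ, ∀ A ∈ QuasiLocal.localOps H Λ,
      UniformCauchySeqOn (fun i t => heisenberg (Q i) t A) l K) (A : QuasiLocal H) :
    UniformCauchySeqOn (fun i t => heisenberg (Q i) t A) l K := by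
  refine QuasiLocal.induction_on_localOps (p := fun A =>
    UniformCauchySeqOn (fun i t => heisenberg (Q i) t A) l K) ?_ hc A
  refine isClosed_of_closure_subset fun A hA u hu => ?_
  obtain ⟨ε, hε, hεu⟩ := Metric.mem_uniformity_dist.mp hu
  obtain ⟨B, hB, hAB⟩ := Metric.mem_closure_iff.mp hA (ε / 3) (by positivity)
  filter_upwards [hB _ (Metric.dist_mem_uniformity (show 0 < ε / 3 by positivity))]
    with m hm t ht
  have h1 := hm t ht
  have h2 : ∀ i, dist (heisenberg (Q i) t A) (heisenberg (Q i) t B) < ε / 3 := fun i => by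
    rw [dist_eq_norm, ← heisenberg_sub, norm_heisenberg (hQ i), ← dist_eq_norm]
    exact hAB
  refine hεu ?_
  have h3 := h2 m.2
  rw [dist_comm] at h3
  have h4 := dist_triangle4 (heisenberg (Q m.1) t A) (heisenberg (Q m.1) t B)
    (heisenberg (Q m.2) t B) (heisenberg (Q m.2) t A)
  have h5 : dist (heisenberg (Q m.1) t B) (heisenberg (Q m.2) t B) < ε / 3 := h1
  linarith [h2 m.1]

/-- Gives the group law of the limit: replacing the inner evolution by its limit costs an error
whose norm the outer evolution preserves. -/
theorem tendsto_heisenberg_add_left [l.NeBot] (hQ : ∀ i, IsSelfAdjoint (Q i))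
    {A B C : QuasiLocal H} {s t : ℝ} (hB : Tendsto (fun i => heisenberg (Q i) t A) l (𝓝 B))
    (hC : Tendsto (fun i => heisenberg (Q i) s B) l (𝓝 C)) :
    Tendsto (fun i => heisenberg (Q i) (s + t) A) l (𝓝 C) := by
  have h : Tendsto (fun i => heisenberg (Q i) (s + t) A - heisenberg (Q i) s B) l (𝓝 0) := by
    rw [tendsto_zero_iff_norm_tendsto_zero]
    simp only [heisenberg_add_left, ← heisenberg_sub, norm_heisenberg (hQ _)]
    exact tendsto_iff_norm_sub_tendsto_zero.mp hB
  simpa using h.add hC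

/-- If the evolutions generated by `Q i` are uniformly Cauchy on bounded time intervals for all
local operators, they converge to a strongly continuous group of automorphisms. -/
theorem exists_isAutomorphismGroup [l.NeBot] (hQ : ∀ i, IsSelfAdjoint (Q i))
    (hc : ∀ (T : ℝ) (Λ : Finset S), ∀ A ∈ QuasiLocal.localOps H Λ,
      UniformCauchySeqOn (fun i t => heisenberg (Q i) t A) l (Set.Icc (-T) T)) :
    ∃ α : ℝ → (QuasiLocal H ≃⋆ₐ[ℂ] QuasiLocal H), IsAutomorphismGroup α ∧
      ∀ (A : QuasiLocal H) (T : ℝ), TendstoUniformlyOn (fun i t => heisenberg (Q i) t A)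
        (fun t => α t A) l (Set.Icc (-T) T) := by
  have hc' := fun T => uniformCauchySeqOn_heisenberg hQ (hc T)
  have hmem : ∀ t : ℝ, t ∈ Set.Icc (-|t|) |t| := fun t => abs_le.mp le_rfl
  have hlim : ∀ (t : ℝ) (A : QuasiLocal H), ∃ B,
      Tendsto (fun i => heisenberg (Q i) t A) l (𝓝 B) := fun t A =>
    cauchy_map_iff_exists_tendsto.mp ((hc' |t| A).cauchy_map (hmem t))
  choose f hf using hlim
  have hadd : ∀ s t A, f (s + t) A = f s (f t A) := fun s t A =>
    tendsto_nhds_unique (hf (s + t) A) (tendsto_heisenberg_add_left hQ (hf t A) (hf s _))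
  have hzero : ∀ A, f 0 A = A := fun A => by
    refine tendsto_nhds_unique (hf 0 A) ?_
    simp only [heisenberg_zero_left]
    exact tendsto_const_nhds
  let α : ℝ → (QuasiLocal H ≃⋆ₐ[ℂ] QuasiLocal H) := fun t =>
    { toFun := f t
      invFun := f (-t)
      left_inv := fun A => by rw [← hadd, neg_add_cancel, hzero]
      right_inv := fun A => by rw [← hadd, add_neg_cancel, hzero]
      map_mul' := fun A B => by
        refine tendsto_nhds_unique (hf t (A * B)) ?_
        simp only [heisenberg_mul]
        exact (hf t A).mul (hf t B)
      map_add' := fun A B => by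
        refine tendsto_nhds_unique (hf t (A + B)) ?_
        simp only [heisenberg_add]
        exact (hf t A).add (hf t B)
      map_star' := fun A => by
        refine tendsto_nhds_unique (hf t (star A)) ?_
        simp only [heisenberg_star (hQ _)]
        exact (hf t A).star
      map_smul' := fun c A => by
        refine tendsto_nhds_unique (hf t (c • A)) ?_
        simp only [heisenberg_smul]
        exact (hf t A).const_smul c }
  have hunif : ∀ (A : QuasiLocal H) (T : ℝ), TendstoUniformlyOn
      (fun i t => heisenberg (Q i) t A) (fun t => α t A) l (Set.Icc (-T) T) := fun A T =>
    (hc' T A).tendstoUniformlyOn_of_tendsto fun t _ => hf t A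
  refine ⟨α, ⟨hzero, hadd, fun A => continuous_iff_continuousAt.mpr fun t => ?_⟩, hunif⟩
  -- The `+ 1` makes the interval a neighbourhood of `t`, so continuity of the uniform limit on it
  -- yields continuity at `t`.
  have h := (hunif A (|t| + 1)).continuousOn
    (Frequently.of_forall fun i => (continuous_heisenberg (Q i) A).continuousOn)
  refine h.continuousAt (Icc_mem_nhds ?_ ?_)
  · linarith [neg_abs_le t]
  · linarith [le_abs_self t]

/-- Injective `*`-homomorphisms of C⋆-algebras are isometric. -/
theorem continuous_starAlgEquiv (f : QuasiLocal H ≃⋆ₐ[ℂ] QuasiLocal H) : Continuous f :=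
  (AddMonoidHomClass.isometry_of_norm f fun A =>
    NonUnitalStarAlgHom.norm_map f f.injective A).continuous

end LimitGroup

/-! ### Lieb-Robinson bound and thermodynamic limit -/

section LiebRobinson

variable {S : Type u}

/-- A function on pairs of sites which is summable and reproduces itself under convolution. -/
structure IsConvolutionWeight (F : S → S → ℝ) (C : ℝ) : Prop where
  nonneg : ∀ x y, 0 ≤ F x y
  one_le : ∀ x, 1 ≤ F x x
  const_nonneg : 0 ≤ C
  conv : ∀ (x y : S) (Λ : Finset S), ∑ z ∈ Λ, F x z * F z y ≤ C * F x y
  summable : ∀ y, Summable fun x => F x y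

/-- The total weight between two finite regions. -/
def totalWeight (F : S → S → ℝ) (X Y : Finset S) : ℝ := ∑ x ∈ X, ∑ y ∈ Y, F x y

theorem mem_regionsIn {Λ : Finset S} {Z : FiniteRegion S} : Z ∈ regionsIn Λ ↔ Z.1 ⊆ Λ := by
  simp [regionsIn]

variable {H : S → Type v} [∀ x, NormedAddCommGroup (H x)]
  [∀ x, InnerProductSpace ℂ (H x)] [∀ x, FiniteDimensional ℂ (H x)] [∀ x, Nontrivial (H x)]

/-- The interaction strength between any two sites `x`, `y` is at most `M * F x y`. -/
def Interaction.IsDominated (Φ : Interaction H) (F : S → S → ℝ) (M : ℝ) : Prop :=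
  ∀ (x y : S) (R : Finset (FiniteRegion S)), (∀ Z ∈ R, x ∈ Z.1 ∧ y ∈ Z.1) →
    ∑ Z ∈ R, ‖Φ.term Z‖ ≤ M * F x y

theorem IsConvolutionWeight.totalWeight_nonneg {F : S → S → ℝ} {C : ℝ}
    (hF : IsConvolutionWeight F C) (X Y : Finset S) : 0 ≤ totalWeight F X Y :=
  Finset.sum_nonneg fun x _ => Finset.sum_nonneg fun y _ => hF.nonneg x y

theorem IsConvolutionWeight.one_le_totalWeight {F : S → S → ℝ} {C : ℝ}
    (hF : IsConvolutionWeight F C) {X Y : Finset S} (h : ¬ Disjoint X Y) :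
    1 ≤ totalWeight F X Y := by
  obtain ⟨x, hX, hY⟩ := Finset.not_disjoint_iff.mp h
  calc 1 ≤ F x x := hF.one_le x
    _ ≤ ∑ y ∈ Y, F x y := Finset.single_le_sum (fun y _ => hF.nonneg x y) hY
    _ ≤ _ := Finset.single_le_sum (f := fun x => ∑ y ∈ Y, F x y)
      (fun x _ => Finset.sum_nonneg fun y _ => hF.nonneg x y) hX

/-- Each `Z` contains some `x ∈ X`, and its weight to `Y` is a sum over `z ∈ Z`. Summing first over
the regions containing both `x` and `z` gives `M * F x z`, and the sum over `z` is then a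
convolution, so the total weight reproduces itself up to the factor `M * C`. -/
theorem Interaction.IsDominated.sum_mul_totalWeight_le {Φ : Interaction H} {F : S → S → ℝ}
    {M C : ℝ} (hΦ : Φ.IsDominated F M) (hF : IsConvolutionWeight F C) (hM : 0 ≤ M)
    {R : Finset (FiniteRegion S)} {X : Finset S} (hR : ∀ Z ∈ R, ¬ Disjoint Z.1 X)
    (Y : Finset S) :
    ∑ Z ∈ R, ‖Φ.term Z‖ * totalWeight F Z.1 Y ≤ M * C * totalWeight F X Y := by
  classical
  -- A common finite range for `z`, so that the sum over `Z` can be moved innermost.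
  let Λ : Finset S := R.biUnion fun Z => Z.1
  have h1 : ∀ Z ∈ R, ‖Φ.term Z‖ * totalWeight F Z.1 Y ≤
      ∑ x ∈ X, ∑ z ∈ Λ, ∑ y ∈ Y, if x ∈ Z.1 ∧ z ∈ Z.1 then ‖Φ.term Z‖ * F z y else 0 := by
    intro Z hZ
    obtain ⟨x, hxZ, hxX⟩ := Finset.not_disjoint_iff.mp (hR Z hZ)
    have hnn : ∀ x z y, 0 ≤ if x ∈ Z.1 ∧ z ∈ Z.1 then ‖Φ.term Z‖ * F z y else 0 := by
      intro x z y
      split_ifs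
      · exact mul_nonneg (norm_nonneg _) (hF.nonneg z y)
      · exact le_rfl
    refine le_trans ?_ (Finset.single_le_sum (f := fun x => ∑ z ∈ Λ, ∑ y ∈ Y,
      if x ∈ Z.1 ∧ z ∈ Z.1 then ‖Φ.term Z‖ * F z y else 0)
      (fun x _ => Finset.sum_nonneg fun z _ => Finset.sum_nonneg fun y _ => hnn x z y) hxX)
    rw [totalWeight, Finset.mul_sum]
    refine le_trans (le_of_eq ?_) (Finset.sum_le_sum_of_subset_of_nonneg
      (Finset.subset_biUnion_of_mem (fun Z : FiniteRegion S => Z.1) hZ)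
      fun z _ _ => Finset.sum_nonneg fun y _ => hnn x z y)
    refine Finset.sum_congr rfl fun z hz => ?_
    rw [Finset.mul_sum]
    exact Finset.sum_congr rfl fun y _ => (if_pos ⟨hxZ, hz⟩).symm
  have h2 : ∀ x z y, ∑ Z ∈ R, (if x ∈ Z.1 ∧ z ∈ Z.1 then ‖Φ.term Z‖ * F z y else 0) ≤
      M * (F x z * F z y) := by
    intro x z y
    rw [← Finset.sum_filter, ← Finset.sum_mul, ← mul_assoc]
    exact mul_le_mul_of_nonneg_right (hΦ x z _ fun Z hZ => (Finset.mem_filter.mp hZ).2)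
      (hF.nonneg z y)
  calc _ ≤ ∑ Z ∈ R, ∑ x ∈ X, ∑ z ∈ Λ, ∑ y ∈ Y,
        (if x ∈ Z.1 ∧ z ∈ Z.1 then ‖Φ.term Z‖ * F z y else 0) := Finset.sum_le_sum h1
    _ = ∑ x ∈ X, ∑ y ∈ Y, ∑ z ∈ Λ, ∑ Z ∈ R,
        (if x ∈ Z.1 ∧ z ∈ Z.1 then ‖Φ.term Z‖ * F z y else 0) := by
      rw [Finset.sum_comm]
      refine Finset.sum_congr rfl fun x _ => ?_
      rw [Finset.sum_comm, Finset.sum_comm (s := Y)]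
      refine Finset.sum_congr rfl fun z _ => ?_
      rw [Finset.sum_comm]
    _ ≤ ∑ x ∈ X, ∑ y ∈ Y, M * C * F x y := by
      refine Finset.sum_le_sum fun x _ => Finset.sum_le_sum fun y _ => ?_
      refine (Finset.sum_le_sum fun z _ => h2 x z y).trans ?_
      rw [← Finset.mul_sum, mul_assoc]
      exact mul_le_mul_of_nonneg_left (hF.conv x y Λ) hM
    _ = _ := by simp only [totalWeight, Finset.mul_sum]

theorem norm_derivation_sum_le {ι : Type*} (s : Finset ι) (q : ι → QuasiLocal H)
    (b : QuasiLocal H) :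
    ‖derivation (∑ i ∈ s, q i) b‖ ≤ ∑ i ∈ s, ‖q i * b - b * q i‖ := by
  rw [norm_derivation, Finset.sum_mul, Finset.mul_sum, ← Finset.sum_sub_distrib]
  exact norm_sum_le _ _

theorem norm_commutator_le (A B : QuasiLocal H) : ‖A * B - B * A‖ ≤ 2 * ‖A‖ * ‖B‖ := by
  refine (norm_sub_le _ _).trans ?_
  linarith [norm_mul_le A B, norm_mul_le B A, mul_comm ‖A‖ ‖B‖]

theorem isSelfAdjoint_sum_term (Φ : Interaction H) (R : Finset (FiniteRegion S)) :
    IsSelfAdjoint (∑ Z ∈ R, Φ.term Z) :=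
  isSelfAdjoint_sum _ fun Z _ => Φ.isSelfAdjoint_term Z

theorem Interaction.isSelfAdjoint_hamiltonian (Φ : Interaction H) (Λ : Finset S) :
    IsSelfAdjoint (Φ.hamiltonian Λ) := isSelfAdjoint_sum_term Φ _

/-- One step of the Lieb-Robinson iteration: the commutator with `A ∈ U_X` grows only through the
terms of the Hamiltonian which meet `X`. -/
theorem norm_commutator_heisenberg_le (Φ : Interaction H) (Λ X : Finset S) {A B : QuasiLocal H}
    (hA : A ∈ QuasiLocal.localOps H X) {β β' : ℝ → ℝ} (hβ : ∀ s, HasDerivAt β (β' s) s)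
    (h0 : 0 ≤ β 0) {R : Finset (FiniteRegion S)}
    (hR : ∀ Z, Z ∈ R ↔ Z ∈ regionsIn Λ ∧ ¬ Disjoint Z.1 X)
    (hle : ∀ s, 0 ≤ s → ∑ Z ∈ R, ‖Φ.term Z * heisenberg (Φ.hamiltonian Λ) (-s) B -
      heisenberg (Φ.hamiltonian Λ) (-s) B * Φ.term Z‖ ≤ β' s) {t : ℝ} (ht : 0 ≤ t) :
    ‖A * heisenberg (Φ.hamiltonian Λ) (-t) B - heisenberg (Φ.hamiltonian Λ) (-t) B * A‖ ≤
      ‖A * B - B * A‖ + 2 * ‖A‖ * β t := by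
  classical
  set b := fun s => heisenberg (Φ.hamiltonian Λ) (-s) B with hb
  -- The terms disjoint from `X`; their evolution fixes `A`, so it can be applied to the commutator
  -- without changing its norm.
  set P : QuasiLocal H := ∑ Z ∈ regionsIn Λ \ R, Φ.term Z with hP
  have hRsub : R ⊆ regionsIn Λ := fun Z hZ => ((hR Z).mp hZ).1
  have hPA : Commute P A := by
    refine Commute.sum_left _ _ _ fun Z hZ => ?_
    rw [Finset.mem_sdiff, hR, not_and, not_not] at hZ
    exact QuasiLocal.commute_of_disjoint (hZ.2 hZ.1) (Φ.term_mem Z) hA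
  have hPQ : P - Φ.hamiltonian Λ = -∑ Z ∈ R, Φ.term Z := by
    rw [hP, Interaction.hamiltonian, ← Finset.sum_sdiff hRsub]
    abel
  have hg := norm_heisenberg_heisenberg_neg_sub_le (Q := Φ.hamiltonian Λ) (T := t)
    (isSelfAdjoint_sum_term Φ (regionsIn Λ \ R)) B hβ h0 (fun s hs => by
      rw [← hP, hPQ, norm_derivation, neg_mul, mul_neg, ← neg_sub', norm_neg,
        ← norm_derivation]
      exact (norm_derivation_sum_le _ _ _).trans (hle s hs.1)) ⟨ht, le_rfl⟩
  set g := heisenberg P t (b t) with hgdef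
  have e : ‖A * b t - b t * A‖ = ‖A * g - g * A‖ := by
    rw [← norm_heisenberg (isSelfAdjoint_sum_term Φ (regionsIn Λ \ R)) t, heisenberg_sub,
      heisenberg_mul, heisenberg_mul, ← hP, heisenberg_of_commute hPA]
  -- Only the deviation of `g` from `B` is new, and Duhamel's comparison bounds it by `β t`.
  calc ‖A * b t - b t * A‖ = ‖(A * B - B * A) + (A * (g - B) - (g - B) * A)‖ := by
        rw [e]; congr 1; simp only [mul_sub, sub_mul]; abel
    _ ≤ ‖A * B - B * A‖ + 2 * ‖A‖ * ‖g - B‖ :=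
        (norm_add_le _ _).trans (add_le_add_right (norm_commutator_le _ _) _)
    _ ≤ _ := by gcongr

variable {Φ : Interaction H} {F : S → S → ℝ} {M C : ℝ}

/-- The commutator vanishes for disjoint regions; otherwise a common site makes the total weight at
least `1`. -/
theorem norm_commutator_le_totalWeight (hF : IsConvolutionWeight F C) {X Y : Finset S}
    {A B : QuasiLocal H} (hA : A ∈ QuasiLocal.localOps H X) (hB : B ∈ QuasiLocal.localOps H Y) :
    ‖A * B - B * A‖ ≤ ‖A‖ * (2 * ‖B‖ * totalWeight F X Y) := by
  have hnn : 0 ≤ 2 * ‖A‖ * ‖B‖ := by positivity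
  by_cases h : Disjoint X Y
  · rw [(QuasiLocal.commute_of_disjoint h hA hB).eq, sub_self, norm_zero]
    exact mul_nonneg (norm_nonneg _) (mul_nonneg (by positivity) (hF.totalWeight_nonneg X Y))
  · have := mul_le_mul_of_nonneg_left (hF.one_le_totalWeight h) hnn
    linarith [norm_commutator_le A B]

theorem hasDerivAt_mul_pow_div_factorial (κ : ℝ) (m : ℕ) (s : ℝ) :
    HasDerivAt (fun s : ℝ => (κ * s) ^ (m + 1) / ((m + 1).factorial : ℝ))
      (κ * ((κ * s) ^ m / (m.factorial : ℝ))) s := by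
  have h2 : HasDerivAt (fun s : ℝ => κ * s) κ s := by
    simpa using (hasDerivAt_id s).const_mul κ
  refine ((h2.pow (m + 1)).div_const ((m + 1).factorial : ℝ)).congr_deriv ?_
  have h0 : ((m : ℝ) + 1) ≠ 0 := by positivity
  have h1 : (m.factorial : ℝ) ≠ 0 := by positivity
  rw [Nat.factorial_succ, Nat.cast_mul, Nat.add_sub_cancel, Nat.cast_succ]
  field_simp

theorem hasDerivAt_exp_mul_sub_one (c s : ℝ) :
    HasDerivAt (fun s : ℝ => Real.exp (c * s) - 1) (Real.exp (c * s) * c) s := by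
  have h1 : HasDerivAt (fun s : ℝ => c * s) c s := by
    simpa using (hasDerivAt_id s).const_mul c
  exact h1.exp.sub_const 1

theorem Interaction.IsDominated.sum_mul_add_le (hΦ : Φ.IsDominated F M)
    (hF : IsConvolutionWeight F C) (hM : 0 ≤ M) {Λ X Y : Finset S}
    {R : Finset (FiniteRegion S)} (hR : ∀ Z ∈ R, ¬ Disjoint Z.1 X) (hRΛ : R ⊆ regionsIn Λ)
    {p q : ℝ} (hp : 0 ≤ p) (hq : 0 ≤ q) :
    ∑ Z ∈ R, ‖Φ.term Z‖ * (p * totalWeight F Z.1 Y + q) ≤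
      p * (M * C * totalWeight F X Y) + q * ∑ Z ∈ regionsIn Λ, ‖Φ.term Z‖ := by
  have h1 := hΦ.sum_mul_totalWeight_le hF hM hR Y
  have h2 : ∑ Z ∈ R, ‖Φ.term Z‖ ≤ ∑ Z ∈ regionsIn Λ, ‖Φ.term Z‖ :=
    Finset.sum_le_sum_of_subset_of_nonneg hRΛ fun _ _ _ => norm_nonneg _
  calc _ = p * ∑ Z ∈ R, ‖Φ.term Z‖ * totalWeight F Z.1 Y + q * ∑ Z ∈ R, ‖Φ.term Z‖ := by
        rw [Finset.mul_sum, Finset.mul_sum, ← Finset.sum_add_distrib]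
        exact Finset.sum_congr rfl fun Z _ => by ring
    _ ≤ _ := add_le_add (mul_le_mul_of_nonneg_left h1 hp) (mul_le_mul_of_nonneg_left h2 hq)

/-- Starting from the trivial commutator bound, every step inserts the previous estimate for the
terms meeting `X`. The first summand depends neither on `m` nor on `Λ`; the remainder depends on `Λ`
but tends to zero as `m` grows. -/
theorem lieb_robinson_iterate (hΦ : Φ.IsDominated F M) (hF : IsConvolutionWeight F C)
    (hM : 0 ≤ M) {Y : Finset S} {B : QuasiLocal H} (hB : B ∈ QuasiLocal.localOps H Y)
    (Λ : Finset S) (m : ℕ) : ∀ (X : Finset S), ∀ A ∈ QuasiLocal.localOps H X, ∀ t : ℝ, 0 ≤ t →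
    ‖A * heisenberg (Φ.hamiltonian Λ) (-t) B - heisenberg (Φ.hamiltonian Λ) (-t) B * A‖ ≤
      ‖A‖ * (2 * ‖B‖ * (Real.exp (2 * (M * C) * t) * totalWeight F X Y) +
        2 * ‖B‖ * (((2 * ∑ Z ∈ regionsIn Λ, ‖Φ.term Z‖) * t) ^ m / m.factorial)) := by
  classical
  obtain ⟨κ, hκ⟩ : ∃ κ, κ = 2 * ∑ Z ∈ regionsIn Λ, ‖Φ.term Z‖ := ⟨_, rfl⟩
  rw [← hκ]
  have hκ0 : 0 ≤ κ := hκ ▸ mul_nonneg zero_le_two (Finset.sum_nonneg fun _ _ => norm_nonneg _)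
  induction m with
  | zero =>
    intro X A _ t _
    have h1 := norm_commutator_le A (heisenberg (Φ.hamiltonian Λ) (-t) B)
    rw [norm_heisenberg (Φ.isSelfAdjoint_hamiltonian Λ)] at h1
    have h2 : 0 ≤ ‖A‖ * (2 * ‖B‖ * (Real.exp (2 * (M * C) * t) * totalWeight F X Y)) := by
      have := hF.totalWeight_nonneg X Y
      positivity
    simp only [pow_zero, Nat.factorial_zero, Nat.cast_one, div_one, mul_one]
    linarith
  | succ m ih =>
    intro X A hA t ht
    set W := totalWeight F X Y with hW
    -- A primitive, zero at `0`, of the bound that the induction hypothesis gives. The commutator at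
    -- time zero, at most `2‖A‖‖B‖W`, compensates the `- 1`, so the same exponential constant
    -- survives each step.
    let β : ℝ → ℝ := fun s => ‖B‖ * W * (Real.exp (2 * (M * C) * s) - 1) +
      ‖B‖ * ((κ * s) ^ (m + 1) / (m + 1).factorial)
    let β' : ℝ → ℝ := fun s => ‖B‖ * W * (Real.exp (2 * (M * C) * s) * (2 * (M * C))) +
      ‖B‖ * (κ * ((κ * s) ^ m / m.factorial))
    have hβ : ∀ s, HasDerivAt β (β' s) s := fun s =>
      ((hasDerivAt_exp_mul_sub_one (2 * (M * C)) s).const_mul (‖B‖ * W)).add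
        ((hasDerivAt_mul_pow_div_factorial κ m s).const_mul ‖B‖)
    have hβ0 : 0 ≤ β 0 := by simp [β]
    obtain ⟨R, hR⟩ : ∃ R : Finset (FiniteRegion S), ∀ Z, Z ∈ R ↔
        Z ∈ regionsIn Λ ∧ ¬ Disjoint Z.1 X :=
      ⟨(regionsIn Λ).filter fun Z => ¬ Disjoint Z.1 X, fun Z => Finset.mem_filter⟩
    have hle : ∀ s, 0 ≤ s → ∑ Z ∈ R, ‖Φ.term Z * heisenberg (Φ.hamiltonian Λ) (-s) B -
        heisenberg (Φ.hamiltonian Λ) (-s) B * Φ.term Z‖ ≤ β' s := by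
      intro s hs
      have hp : 0 ≤ 2 * ‖B‖ * Real.exp (2 * (M * C) * s) := by positivity
      have hq : 0 ≤ 2 * ‖B‖ * ((κ * s) ^ m / (m.factorial : ℝ)) := by positivity
      have h := hΦ.sum_mul_add_le hF hM (Λ := Λ) (X := X) (Y := Y) (R := R)
        (fun Z hZ => ((hR Z).mp hZ).2) (fun Z hZ => ((hR Z).mp hZ).1) hp hq
      have h' : ∑ Z ∈ R, ‖Φ.term Z * heisenberg (Φ.hamiltonian Λ) (-s) B -
          heisenberg (Φ.hamiltonian Λ) (-s) B * Φ.term Z‖ ≤ ∑ Z ∈ R, ‖Φ.term Z‖ *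
          (2 * ‖B‖ * Real.exp (2 * (M * C) * s) * totalWeight F Z.1 Y +
            2 * ‖B‖ * ((κ * s) ^ m / (m.factorial : ℝ))) := by
        refine Finset.sum_le_sum fun Z _ => ?_
        rw [mul_assoc (2 * ‖B‖)]
        exact ih Z.1 _ (Φ.term_mem Z) s hs
      refine (h'.trans h).trans (le_of_eq ?_)
      simp only [β', hκ, hW]
      ring
    have h1 := norm_commutator_heisenberg_le Φ Λ X hA hβ hβ0
      hR hle ht
    have h2 := norm_commutator_le_totalWeight hF hA hB
    calc _ ≤ _ := h1
      _ ≤ ‖A‖ * (2 * ‖B‖ * W) + 2 * ‖A‖ * β t := add_le_add_left h2 _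
      _ = _ := by simp only [β]; ring

/-- The Lieb-Robinson bound. -/
theorem lieb_robinson (hΦ : Φ.IsDominated F M) (hF : IsConvolutionWeight F C)
    (hM : 0 ≤ M) {X Y : Finset S} {A B : QuasiLocal H} (hA : A ∈ QuasiLocal.localOps H X)
    (hB : B ∈ QuasiLocal.localOps H Y) (Λ : Finset S) {t : ℝ} (ht : 0 ≤ t) :
    ‖A * heisenberg (Φ.hamiltonian Λ) (-t) B - heisenberg (Φ.hamiltonian Λ) (-t) B * A‖ ≤
      ‖A‖ * (2 * ‖B‖ * (Real.exp (2 * (M * C) * t) * totalWeight F X Y)) := by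
  -- Letting `m → ∞` at fixed `Λ` removes the volume-dependent remainder.
  have h := ((((FloorSemiring.tendsto_pow_div_factorial_atTop
    ((2 * ∑ Z ∈ regionsIn Λ, ‖Φ.term Z‖) * t)).const_mul (2 * ‖B‖)).const_add
    (2 * ‖B‖ * (Real.exp (2 * (M * C) * t) * totalWeight F X Y))).const_mul ‖A‖)
  rw [mul_zero, add_zero] at h
  exact ge_of_tendsto' h fun m => lieb_robinson_iterate hΦ hF hM hB Λ m X A hA t ht

/-- Comparison of the dynamics in two volumes. -/
theorem norm_heisenberg_hamiltonian_sub_le [DecidableEq S] (hΦ : Φ.IsDominated F M)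
    (hF : IsConvolutionWeight F C) (hM : 0 ≤ M) {Y : Finset S} {B : QuasiLocal H}
    (hB : B ∈ QuasiLocal.localOps H Y) {Λ Λ' : Finset S} (hΛ : Λ ⊆ Λ') {t T : ℝ} (ht : 0 ≤ t)
    (htT : t ≤ T) :
    ‖heisenberg (Φ.hamiltonian Λ') (-t) B - heisenberg (Φ.hamiltonian Λ) (-t) B‖ ≤
      2 * ‖B‖ * Real.exp (2 * (M * C) * T) * (M * C) * T * totalWeight F (Λ' \ Λ) Y := by
  set K := 2 * ‖B‖ * Real.exp (2 * (M * C) * T) * (M * C) * totalWeight F (Λ' \ Λ) Y with hK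
  have hMC : 0 ≤ M * C := mul_nonneg hM hF.const_nonneg
  have hK0 : 0 ≤ K := by
    have := hF.totalWeight_nonneg (Λ' \ Λ) Y
    positivity
  have hsub : regionsIn Λ ⊆ regionsIn Λ' := fun Z hZ =>
    mem_regionsIn.mpr ((mem_regionsIn.mp hZ).trans hΛ)
  classical
  have hdiff : Φ.hamiltonian Λ' - Φ.hamiltonian Λ =
      ∑ Z ∈ regionsIn Λ' \ regionsIn Λ, Φ.term Z := by
    rw [Interaction.hamiltonian, Interaction.hamiltonian, ← Finset.sum_sdiff hsub,
      add_sub_cancel_right]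
  -- Every additional term touches the additional sites, so their weight to `Y` controls the
  -- difference.
  have hmeet : ∀ Z ∈ regionsIn Λ' \ regionsIn Λ, ¬ Disjoint Z.1 (Λ' \ Λ) := by
    intro Z hZ
    rw [Finset.mem_sdiff, mem_regionsIn, mem_regionsIn] at hZ
    obtain ⟨x, hxZ, hx⟩ := Finset.not_subset.mp hZ.2
    exact Finset.not_disjoint_iff.mpr ⟨x, hxZ, Finset.mem_sdiff.mpr ⟨hZ.1 hxZ, hx⟩⟩
  have h := norm_heisenberg_heisenberg_neg_sub_le (Q := Φ.hamiltonian Λ) (T := t)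
    (Φ.isSelfAdjoint_hamiltonian Λ') B (β := fun s => K * s) (β' := fun _ => K)
    (fun s => by simpa using (hasDerivAt_id s).const_mul K) (by simp) (fun s hs => by
      rw [hdiff]
      refine (norm_derivation_sum_le _ _ _).trans ?_
      refine (Finset.sum_le_sum fun Z _ =>
        lieb_robinson hΦ hF hM (Φ.term_mem Z) hB Λ hs.1).trans ?_
      have h1 := hΦ.sum_mul_totalWeight_le hF hM hmeet Y
      have h2 : Real.exp (2 * (M * C) * s) ≤ Real.exp (2 * (M * C) * T) := by
        refine Real.exp_le_exp.mpr (mul_le_mul_of_nonneg_left (hs.2.le.trans htT) (by positivity))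
      calc _ = 2 * ‖B‖ * Real.exp (2 * (M * C) * s) *
            ∑ Z ∈ regionsIn Λ' \ regionsIn Λ, ‖Φ.term Z‖ * totalWeight F Z.1 Y := by
            rw [Finset.mul_sum]
            exact Finset.sum_congr rfl fun Z _ => by ring
        _ ≤ 2 * ‖B‖ * Real.exp (2 * (M * C) * T) * (M * C * totalWeight F (Λ' \ Λ) Y) := by
            refine mul_le_mul (mul_le_mul_of_nonneg_left h2 (by positivity)) h1
              (Finset.sum_nonneg fun Z _ => ?_) (by positivity)
            exact mul_nonneg (norm_nonneg _) (hF.totalWeight_nonneg _ _)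
        _ = K := by rw [hK]; ring) ⟨ht, le_rfl⟩
  -- Applying the isometric evolution of `Λ'` brings the difference into the form treated by
  -- Duhamel's comparison.
  rw [norm_sub_rev, ← norm_heisenberg (Φ.isSelfAdjoint_hamiltonian Λ') t, heisenberg_sub,
    heisenberg_heisenberg_neg]
  calc _ ≤ K * t := h
    _ ≤ K * T := mul_le_mul_of_nonneg_left htT hK0
    _ = _ := by rw [hK]; ring

/-- The interaction with all signs reversed. -/
def Interaction.neg (Φ : Interaction H) : Interaction H where
  term Z := -Φ.term Z
  term_mem Z := neg_mem (Φ.term_mem Z)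
  isSelfAdjoint_term Z := (Φ.isSelfAdjoint_term Z).neg

theorem Interaction.hamiltonian_neg (Φ : Interaction H) (Λ : Finset S) :
    Φ.neg.hamiltonian Λ = -Φ.hamiltonian Λ := Finset.sum_neg_distrib _

theorem Interaction.IsDominated.neg (hΦ : Φ.IsDominated F M) : Φ.neg.IsDominated F M := by
  intro x y R hR
  simpa only [Interaction.neg, norm_neg] using hΦ x y R hR

/-- The one-sided estimate covers evolution times `-t ≤ 0`; reversing the sign of the interaction
gives the others. -/
theorem norm_heisenberg_hamiltonian_sub_le' [DecidableEq S] (hΦ : Φ.IsDominated F M)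
    (hF : IsConvolutionWeight F C) (hM : 0 ≤ M) {Y : Finset S} {B : QuasiLocal H}
    (hB : B ∈ QuasiLocal.localOps H Y) {Λ Λ' : Finset S} (hΛ : Λ ⊆ Λ') {t T : ℝ}
    (ht : t ∈ Set.Icc (-T) T) :
    ‖heisenberg (Φ.hamiltonian Λ') t B - heisenberg (Φ.hamiltonian Λ) t B‖ ≤
      2 * ‖B‖ * Real.exp (2 * (M * C) * T) * (M * C) * T * totalWeight F (Λ' \ Λ) Y := by
  rcases le_total 0 t with h | h
  · have := norm_heisenberg_hamiltonian_sub_le hΦ.neg hF hM hB hΛ h ht.2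
    simpa only [Interaction.hamiltonian_neg, heisenberg_neg, neg_neg] using this
  · have := norm_heisenberg_hamiltonian_sub_le hΦ hF hM hB hΛ (neg_nonneg.mpr h)
      (neg_le.mp ht.1)
    simpa only [neg_neg] using this

/-- The local dynamics are uniformly Cauchy as the volume tends to the whole lattice. -/
theorem uniformCauchySeqOn_hamiltonian (hΦ : Φ.IsDominated F M)
    (hF : IsConvolutionWeight F C) (hM : 0 ≤ M) (T : ℝ) (Y : Finset S) (B : QuasiLocal H)
    (hB : B ∈ QuasiLocal.localOps H Y) :
    UniformCauchySeqOn (fun Λ t => heisenberg (Φ.hamiltonian Λ) t B) atTop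
      (Set.Icc (-T) T) := by
  classical
  intro u hu
  obtain ⟨ε, hε, hεu⟩ := Metric.mem_uniformity_dist.mp hu
  -- `|T|` keeps `K` nonnegative when `T < 0`, where the time interval is empty; `K + 1` below
  -- avoids dividing by zero.
  set K := 2 * ‖B‖ * Real.exp (2 * (M * C) * T) * (M * C) * |T| with hK
  have hMC : 0 ≤ M * C := mul_nonneg hM hF.const_nonneg
  have hK0 : 0 ≤ K := by positivity
  have hsum : Summable fun x => ∑ y ∈ Y, F x y := summable_sum fun y _ => hF.summable y
  obtain ⟨Λ₀, hΛ₀⟩ := summable_iff_vanishing_norm.mp hsum (ε / (2 * (K + 1))) (by positivity)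
  have key : ∀ Λ, Λ₀ ⊆ Λ → ∀ t ∈ Set.Icc (-T) T,
      dist (heisenberg (Φ.hamiltonian Λ) t B) (heisenberg (Φ.hamiltonian Λ₀) t B) < ε / 2 := by
    intro Λ hΛ t ht
    have hT : 0 ≤ T := by linarith [ht.1, ht.2]
    rw [dist_eq_norm]
    refine (norm_heisenberg_hamiltonian_sub_le' hΦ hF hM hB hΛ ht).trans_lt ?_
    have h1 : totalWeight F (Λ \ Λ₀) Y < ε / (2 * (K + 1)) :=
      (le_abs_self _).trans_lt (hΛ₀ _ Finset.sdiff_disjoint)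
    rw [abs_of_nonneg hT] at hK
    rw [← hK]
    calc K * totalWeight F (Λ \ Λ₀) Y ≤ (K + 1) * totalWeight F (Λ \ Λ₀) Y :=
          mul_le_mul_of_nonneg_right (by linarith) (hF.totalWeight_nonneg _ _)
      _ < (K + 1) * (ε / (2 * (K + 1))) := mul_lt_mul_of_pos_left h1 (by positivity)
      _ = ε / 2 := by field_simp
  have hev : ∀ᶠ Λ in (atTop : Filter (Finset S)), Λ₀ ⊆ Λ := eventually_ge_atTop Λ₀
  filter_upwards [hev.prod_mk hev] with m hm t ht
  refine hεu ?_
  have h1 := key m.1 hm.1 t ht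
  have h2 := key m.2 hm.2 t ht
  rw [dist_comm] at h2
  have h3 := dist_triangle (heisenberg (Φ.hamiltonian m.1) t B)
    (heisenberg (Φ.hamiltonian Λ₀) t B) (heisenberg (Φ.hamiltonian m.2) t B)
  linarith

end LiebRobinson

/-! ### Power-law weights on a lattice of finite effective dimension -/

section PowerDecay

variable {d : ℕ} {L : Set (EuclideanSpace ℝ (Fin d))}

/-- The weight `(1 + |x - y|)^(-p)`. -/
def powerWeight (L : Set (EuclideanSpace ℝ (Fin d))) (p : ℝ) (x y : L) : ℝ :=
  (1 + dist x y) ^ (-p)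

theorem powerWeight_nonneg (p : ℝ) (x y : L) : 0 ≤ powerWeight L p x y :=
  Real.rpow_nonneg (by positivity) _

theorem powerWeight_comm (p : ℝ) (x y : L) : powerWeight L p x y = powerWeight L p y x := by
  rw [powerWeight, powerWeight, dist_comm]

theorem HasEffectiveDimension.exists_card_le {γ : ℝ} (hL : HasEffectiveDimension L γ) :
    ∃ C ≥ (0 : ℝ), ∀ (y : L) (m : ℕ) (s : Finset L), (∀ x ∈ s, dist x y < m + 1) →
      (s.card : ℝ) ≤ C * ((m : ℝ) + 1) ^ γ := by
  obtain ⟨C, hC, r₀, hr₀, h⟩ := hL.growth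
  -- The radius is enlarged to `m + 1 + r₀ ≤ (1 + r₀)(m + 1)`, so that the growth bound applies at
  -- every scale.
  refine ⟨C * (1 + r₀) ^ γ, by positivity, fun y m s hs => ?_⟩
  obtain ⟨hfin, hcard⟩ := h (m + 1 + r₀) (by linarith [(Nat.cast_nonneg m : (0 : ℝ) ≤ m)]) y y.2
  have h1 : (s.card : ℝ) ≤ (Metric.ball (y : EuclideanSpace ℝ (Fin d)) (m + 1 + r₀) ∩ L).ncard := by
    rw [← Finset.card_map (Function.Embedding.subtype _), ← Set.ncard_coe_finset]
    refine Nat.cast_le.mpr (Set.ncard_le_ncard (fun x hx => ?_) hfin)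
    obtain ⟨z, hz, rfl⟩ := Finset.mem_map.mp (Finset.mem_coe.mp hx)
    have := hs z hz
    rw [Subtype.dist_eq] at this
    exact ⟨Metric.mem_ball.mpr (by simpa using by linarith), z.2⟩
  refine h1.trans (hcard.trans ?_)
  rw [mul_assoc, ← Real.mul_rpow (by positivity) (by positivity)]
  refine mul_le_mul_of_nonneg_left (Real.rpow_le_rpow (by positivity) ?_ hL.pos.le) hC
  nlinarith [(Nat.cast_nonneg m : (0 : ℝ) ≤ m)]

/-- Sites are grouped by the integer part `m` of their distance to `y`. A shell is counted by the
ball containing it, at most `C (m + 1)^γ` sites; the exponent `γ + 1 + ε` then leaves the summable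
`(m + 1)^(-(1 + ε))`. -/
theorem HasEffectiveDimension.exists_sum_powerWeight_le {γ : ℝ} (hL : HasEffectiveDimension L γ)
    {ε : ℝ} (hε : 0 < ε) :
    ∃ D ≥ (0 : ℝ), ∀ (y : L) (s : Finset L), ∑ x ∈ s, powerWeight L (γ + 1 + ε) x y ≤ D := by
  classical
  obtain ⟨C, hC, hcard⟩ := hL.exists_card_le
  have hsum : Summable fun m : ℕ => C * ((m : ℝ) + 1) ^ (-(1 + ε)) := by
    refine Summable.mul_left C ?_
    have h := (Real.summable_one_div_nat_add_rpow 1 (1 + ε)).mpr (by linarith)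
    refine h.congr fun m => ?_
    have hm : (0 : ℝ) ≤ (m : ℝ) + 1 := by positivity
    rw [abs_of_nonneg hm, Real.rpow_neg hm, one_div]
  have hnn : ∀ m : ℕ, 0 ≤ C * ((m : ℝ) + 1) ^ (-(1 + ε)) := fun m => by positivity
  refine ⟨∑' m : ℕ, C * ((m : ℝ) + 1) ^ (-(1 + ε)), tsum_nonneg hnn, fun y s => ?_⟩
  let g : L → ℕ := fun x => ⌊dist x y⌋₊
  rw [← Finset.sum_fiberwise_of_maps_to (t := s.image g) (g := g)
    fun x hx => Finset.mem_image_of_mem g hx]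
  refine (Finset.sum_le_sum fun m _ => ?_).trans (hsum.sum_le_tsum (s.image g) fun m _ => hnn m)
  have hm : (0 : ℝ) < (m : ℝ) + 1 := by positivity
  have h1 : ∀ x ∈ s.filter (fun x => g x = m),
      powerWeight L (γ + 1 + ε) x y ≤ ((m : ℝ) + 1) ^ (-(γ + 1 + ε)) := by
    intro x hx
    have hx' : (m : ℝ) ≤ dist x y := by
      rw [← (Finset.mem_filter.mp hx).2]
      exact Nat.floor_le dist_nonneg
    exact Real.rpow_le_rpow_of_nonpos hm (by linarith) (by linarith [hL.pos])
  have h2 := hcard y m (s.filter fun x => g x = m) fun x hx => by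
    rw [← (Finset.mem_filter.mp hx).2]
    exact Nat.lt_floor_add_one _
  calc _ ≤ ((s.filter fun x => g x = m).card : ℝ) * ((m : ℝ) + 1) ^ (-(γ + 1 + ε)) := by
        simpa only [nsmul_eq_mul] using Finset.sum_le_card_nsmul _ _ _ h1
    _ ≤ C * ((m : ℝ) + 1) ^ γ * ((m : ℝ) + 1) ^ (-(γ + 1 + ε)) := by gcongr
    _ = _ := by
        rw [mul_assoc, ← Real.rpow_add hm]
        congr 2
        ring

/-- By the triangle inequality the larger of `1 + |x - z|` and `1 + |z - y|` is at least half of `1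
+ |x - y|`, so its factor is at most `2^p` times the weight of `x, y`. -/
theorem powerWeight_mul_le {p : ℝ} (hp : 0 ≤ p) (x y z : L) :
    powerWeight L p x z * powerWeight L p z y ≤
      2 ^ p * powerWeight L p x y * (powerWeight L p z x + powerWeight L p z y) := by
  have key : ∀ u v w : ℝ, 0 < u → 0 < v → 0 < w → w ≤ u + v → u ≤ v →
      u ^ (-p) * v ^ (-p) ≤ 2 ^ p * w ^ (-p) * (u ^ (-p) + v ^ (-p)) := by
    intro u v w hu hv hw h huv
    have h1 : v ^ (-p) ≤ 2 ^ p * w ^ (-p) := by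
      have h2 : v ^ (-p) ≤ (w / 2) ^ (-p) :=
        Real.rpow_le_rpow_of_nonpos (by positivity) (by linarith) (by linarith)
      rw [Real.div_rpow hw.le zero_le_two, Real.rpow_neg zero_le_two, div_inv_eq_mul] at h2
      linarith
    have hu' : 0 ≤ u ^ (-p) := by positivity
    have hv' : 0 ≤ v ^ (-p) := by positivity
    have hw' : 0 ≤ 2 ^ p * w ^ (-p) := by positivity
    nlinarith [mul_le_mul_of_nonneg_left h1 hu', mul_nonneg hw' hv']
  have h := dist_triangle x z y
  have h1 : 0 ≤ dist x z := dist_nonneg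
  have h2 : 0 ≤ dist z y := dist_nonneg
  have h3 : 0 ≤ dist x y := dist_nonneg
  rw [powerWeight_comm p z x]
  unfold powerWeight
  rcases le_total (dist x z) (dist z y) with h' | h'
  · exact key _ _ _ (by linarith) (by linarith) (by linarith) (by linarith) (by linarith)
  · rw [mul_comm, add_comm ((1 + dist x z) ^ (-p))]
    exact key _ _ _ (by linarith) (by linarith) (by linarith) (by linarith) (by linarith)

theorem HasEffectiveDimension.exists_isConvolutionWeight {γ : ℝ}
    (hL : HasEffectiveDimension L γ) {ε : ℝ} (hε : 0 < ε) :
    ∃ C, IsConvolutionWeight (powerWeight L (γ + 1 + ε)) C := by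
  obtain ⟨D, hD, hsum⟩ := hL.exists_sum_powerWeight_le hε
  have hp : 0 ≤ γ + 1 + ε := by linarith [hL.pos]
  refine ⟨2 ^ (γ + 1 + ε) * (D + D), powerWeight_nonneg _, fun x => ?_, by positivity,
    fun x y Λ => ?_, fun y => summable_of_sum_le (fun x => powerWeight_nonneg _ x y) (hsum y)⟩
  · simp [powerWeight]
  · refine (Finset.sum_le_sum fun z _ => powerWeight_mul_le hp x y z).trans ?_
    rw [← Finset.mul_sum, Finset.sum_add_distrib]
    have h := powerWeight_nonneg (γ + 1 + ε) x y
    calc _ ≤ 2 ^ (γ + 1 + ε) * powerWeight L (γ + 1 + ε) x y * (D + D) :=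
          mul_le_mul_of_nonneg_left (add_le_add (hsum x Λ) (hsum y Λ)) (by positivity)
      _ = _ := by ring

variable {H : L → Type v} [∀ x, NormedAddCommGroup (H x)]
  [∀ x, InnerProductSpace ℂ (H x)] [∀ x, FiniteDimensional ℂ (H x)] [∀ x, Nontrivial (H x)]

/-- Passes from the extended-real supremum to real bounds on finite sums; `M` is the supremum
itself. -/
theorem Interaction.exists_isDominated {Φ : Interaction H} {p : ℝ}
    (h : (⨆ (x : L) (y : L), ENNReal.ofReal ((1 + dist x y) ^ p) *
      ∑' Λ : {Λ : FiniteRegion L // x ∈ Λ.1 ∧ y ∈ Λ.1}, ‖Φ.term Λ.1‖ₑ) < ⊤) :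
    ∃ M ≥ (0 : ℝ), Φ.IsDominated (powerWeight L p) M := by
  classical
  refine ⟨_, ENNReal.toReal_nonneg (a := ⨆ (x : L) (y : L),
    ENNReal.ofReal ((1 + dist x y) ^ p) *
      ∑' Λ : {Λ : FiniteRegion L // x ∈ Λ.1 ∧ y ∈ Λ.1}, ‖Φ.term Λ.1‖ₑ), fun x y R hR => ?_⟩
  have hpos : 0 < (1 + dist x y) ^ p := Real.rpow_pos_of_pos (by positivity) p
  have h1 : ENNReal.ofReal ((1 + dist x y) ^ p * ∑ Z ∈ R, ‖Φ.term Z‖) ≤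
      ⨆ (x : L) (y : L), ENNReal.ofReal ((1 + dist x y) ^ p) *
      ∑' Λ : {Λ : FiniteRegion L // x ∈ Λ.1 ∧ y ∈ Λ.1}, ‖Φ.term Λ.1‖ₑ := by
    refine le_trans ?_ (le_iSup₂ (f := fun x y : L => ENNReal.ofReal ((1 + dist x y) ^ p) *
      ∑' Λ : {Λ : FiniteRegion L // x ∈ Λ.1 ∧ y ∈ Λ.1}, ‖Φ.term Λ.1‖ₑ) x y)
    rw [ENNReal.ofReal_mul hpos.le]
    refine mul_le_mul_right ?_ _
    rw [ENNReal.ofReal_sum_of_nonneg fun _ _ => norm_nonneg _]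
    simp only [ofReal_norm]
    rw [← Finset.sum_subtype_of_mem (p := fun Λ : FiniteRegion L => x ∈ Λ.1 ∧ y ∈ Λ.1)
      (fun Z => ‖Φ.term Z‖ₑ) hR]
    exact ENNReal.sum_le_tsum _
  have h2 := (ENNReal.ofReal_le_iff_le_toReal h.ne).mp h1
  rw [powerWeight, Real.rpow_neg (by positivity), ← div_eq_mul_inv, le_div_iff₀ hpos, mul_comm]
  exact h2

end PowerDecay

/-! ### Existence, uniqueness and commutation of the two groups -/

section Existence

variable {d : ℕ} {L : Set (EuclideanSpace ℝ (Fin d))} {H : L → Type v}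
  [∀ x, NormedAddCommGroup (H x)] [∀ x, InnerProductSpace ℂ (H x)]
  [∀ x, FiniteDimensional ℂ (H x)] [∀ x, Nontrivial (H x)]

theorem exists_induces {γ : ℝ} (hL : HasEffectiveDimension L γ) {n : L → QuasiLocal H} {k : ℕ}
    {Φ : Interaction H} (hΦ : Φ.IsSymmetric n γ k) :
    ∃ α : ℝ → (QuasiLocal H ≃⋆ₐ[ℂ] QuasiLocal H), Φ.Induces α := by
  obtain ⟨ε, hε, h⟩ := hΦ.decay'
  obtain ⟨M, hM, hdom⟩ := Interaction.exists_isDominated h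
  obtain ⟨C, hF⟩ := hL.exists_isConvolutionWeight hε
  obtain ⟨α, hα, hlim⟩ := exists_isAutomorphismGroup (l := atTop) (Q := Φ.hamiltonian)
    Φ.isSelfAdjoint_hamiltonian (uniformCauchySeqOn_hamiltonian hdom hF hM)
  refine ⟨α, hα, fun Λ hmono hex A K hK => ?_⟩
  obtain ⟨T, hT⟩ := hK.isBounded.subset_closedBall 0
  rw [Real.closedBall_eq_Icc, zero_sub, zero_add] at hT
  intro u hu
  -- The limit is taken along all finite volumes, so every exhausting sequence inherits it.
  exact (tendsto_atTop_finset_of_monotone hmono hex).eventually ((hlim A T).mono hT u hu)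

theorem exists_exhaustion (hL : L.Countable) :
    ∃ Λ : ℕ → Finset L, Monotone Λ ∧ ∀ x, ∃ m, x ∈ Λ m := by
  have : Countable L := hL
  obtain ⟨f, hf⟩ := exists_injective_nat L
  refine ⟨fun m => ((Set.finite_Iio m).preimage hf.injOn).toFinset, fun i j hij x hx => ?_,
    fun x => ⟨f x + 1, ?_⟩⟩
  · simp only [Set.Finite.mem_toFinset, Set.mem_preimage, Set.mem_Iio] at hx ⊢
    omega
  · simp

theorem Interaction.Induces.tendsto_heisenberg {Φ : Interaction H}
    {α : ℝ → (QuasiLocal H ≃⋆ₐ[ℂ] QuasiLocal H)} (hα : Φ.Induces α) {Λ : ℕ → Finset L}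
    (hΛ : Monotone Λ) (hex : ∀ x, ∃ m, x ∈ Λ m) (t : ℝ) (A : QuasiLocal H) :
    Tendsto (fun m => heisenberg (Φ.hamiltonian (Λ m)) t A) atTop (𝓝 (α t A)) :=
  (hα.tendsto Λ hΛ hex A {t} isCompact_singleton).tendsto_at rfl

/-- Countability enters here: some exhausting sequence must exist for the limits to determine the
group. -/
theorem Interaction.Induces.unique (hL : L.Countable) {Φ : Interaction H}
    {α β : ℝ → (QuasiLocal H ≃⋆ₐ[ℂ] QuasiLocal H)} (hα : Φ.Induces α) (hβ : Φ.Induces β) :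
    α = β := by
  obtain ⟨Λ, hΛ, hex⟩ := exists_exhaustion hL
  funext t
  ext A
  exact tendsto_nhds_unique (hα.tendsto_heisenberg hΛ hex t A) (hβ.tendsto_heisenberg hΛ hex t A)

theorem IsMultipoleGroup.unique {n : L → QuasiLocal H} {a : Fin d → ℕ}
    {σ τ : ℝ → (QuasiLocal H ≃⋆ₐ[ℂ] QuasiLocal H)} (hσ : IsMultipoleGroup n a σ)
    (hτ : IsMultipoleGroup n a τ) : σ = τ := by
  funext s
  ext A
  refine QuasiLocal.induction_on_localOps (p := fun A => σ s A = τ s A)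
    (isClosed_eq (continuous_starAlgEquiv _) (continuous_starAlgEquiv _)) (fun Λ A hA => ?_) A
  rw [hσ.apply_local s Λ A hA, hτ.apply_local s Λ A hA]

/-- Such sites lie within `R₀` of `Λ`. Finiteness makes the `finsum` in `multipoleMoment` a genuine
finite sum. -/
theorem IsChargeFamily.finite_chargesMeeting {γ : ℝ} (hL : HasEffectiveDimension L γ)
    {n : L → QuasiLocal H} (hn : IsChargeFamily n) (Λ : Finset L) :
    (chargesMeeting n Λ).Finite := by
  obtain ⟨R₀, hR₀, hsupp⟩ := hn.finiteRange
  obtain ⟨C, hC, r₀, hr₀, h⟩ := hL.growth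
  -- Adding `r₀` makes the radius large enough for the growth bound.
  have hball : ∀ y : L, (Metric.ball y (R₀ + r₀)).Finite := fun y => by
    refine (((h (R₀ + r₀) (by linarith) y y.2).1).preimage
      Subtype.val_injective.injOn).subset fun x hx => ⟨?_, x.2⟩
    exact hx
  refine (Set.Finite.biUnion Λ.finite_toSet fun y _ => hball y).subset ?_
  rintro x ⟨y, hy, hyΛ⟩
  refine Set.mem_biUnion hyΛ ?_
  have := Metric.mem_ball.mp (hsupp x hy)
  rw [dist_comm] at this
  exact Metric.mem_ball.mpr (by linarith)

/-- The moment `x ↦ x^a`, as a complex number. -/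
def monomial (a : Fin d → ℕ) (x : L) : ℂ :=
  ((∏ j, (x : EuclideanSpace ℝ (Fin d)) j ^ a j : ℝ) : ℂ)

theorem IsChargeFamily.multipoleMoment_eq {γ : ℝ} (hL : HasEffectiveDimension L γ)
    {n : L → QuasiLocal H} (hn : IsChargeFamily n) (a : Fin d → ℕ) (Λ : Finset L) :
    multipoleMoment n a Λ =
      ∑ x ∈ (hn.finite_chargesMeeting hL Λ).toFinset, monomial a x • n x :=
  finsum_mem_eq_finite_toFinset_sum _ _

theorem IsChargeFamily.isSelfAdjoint_multipoleMoment {γ : ℝ} (hL : HasEffectiveDimension L γ)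
    {n : L → QuasiLocal H} (hn : IsChargeFamily n) (a : Fin d → ℕ) (Λ : Finset L) :
    IsSelfAdjoint (multipoleMoment n a Λ) := by
  rw [hn.multipoleMoment_eq hL]
  refine isSelfAdjoint_sum _ fun x _ => ?_
  rw [isSelfAdjoint_iff, star_smul, (hn.isSelfAdjoint x).star_eq, monomial, Complex.star_def,
    Complex.conj_ofReal]

theorem chargesMeeting_mono (n : L → QuasiLocal H) {Λ Λ' : Finset L} (h : Λ ⊆ Λ') :
    chargesMeeting n Λ ⊆ chargesMeeting n Λ' := fun _ hx =>
  hx.mono (Set.inter_subset_inter_right _ (Finset.coe_subset.mpr h))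

/-- On `U_Λ` the multipole moments of all larger volumes generate the same evolution. -/
theorem IsChargeFamily.heisenberg_multipoleMoment {γ : ℝ} (hL : HasEffectiveDimension L γ)
    {n : L → QuasiLocal H} (hn : IsChargeFamily n) (a : Fin d → ℕ) {Λ Λ' : Finset L}
    (h : Λ ⊆ Λ') {A : QuasiLocal H} (hA : A ∈ QuasiLocal.localOps H Λ) (s : ℝ) :
    heisenberg (multipoleMoment n a Λ') s A = heisenberg (multipoleMoment n a Λ) s A := by
  classical
  have hsub : (hn.finite_chargesMeeting hL Λ).toFinset ⊆
      (hn.finite_chargesMeeting hL Λ').toFinset :=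
    Set.Finite.toFinset_mono (chargesMeeting_mono n h)
  rw [hn.multipoleMoment_eq hL, hn.multipoleMoment_eq hL, ← Finset.sum_sdiff hsub, add_comm]
  refine heisenberg_add_of_commute ?_ ?_ s
  · exact Commute.sum_left _ _ _ fun x _ => Commute.sum_right _ _ _ fun y _ =>
      ((hn.commute x y).smul_left _).smul_right _
  -- The extra charges have supports that miss `Λ`, so they commute with `A`.
  · refine Commute.sum_left _ _ _ fun x hx => Commute.smul_left ?_ _
    refine QuasiLocal.commute_of_supp_disjoint (hn.isLocal x) (fun hne => ?_) hA
    exact (Finset.mem_sdiff.mp hx).2 ((Set.Finite.mem_toFinset _).mpr hne)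

/-- On each `U_Λ` the approximating evolutions are constant once the volume contains `Λ`, so they
are trivially Cauchy. The generators carry a minus sign because `τ_s` is conjugation by `exp(-isQ)`.
-/
theorem IsChargeFamily.exists_isMultipoleGroup {γ : ℝ} (hL : HasEffectiveDimension L γ)
    {n : L → QuasiLocal H} (hn : IsChargeFamily n) (a : Fin d → ℕ) :
    ∃ τ : ℝ → (QuasiLocal H ≃⋆ₐ[ℂ] QuasiLocal H), IsMultipoleGroup n a τ := by
  have hstat : ∀ (Λ : Finset L), ∀ A ∈ QuasiLocal.localOps H Λ, ∀ s : ℝ,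
      ∀ Λ' ∈ Set.Ici Λ, heisenberg (-multipoleMoment n a Λ') s A = localMultipole n a s Λ A := by
    intro Λ A hA s Λ' hΛ'
    rw [heisenberg_neg, hn.heisenberg_multipoleMoment hL a hΛ' hA]
    rfl
  obtain ⟨τ, hτ, hlim⟩ := exists_isAutomorphismGroup (l := atTop)
    (Q := fun Λ : Finset L => -multipoleMoment n a Λ)
    (fun Λ => (hn.isSelfAdjoint_multipoleMoment hL a Λ).neg) (fun T Λ A hA u hu => by
      have hev : ∀ᶠ Λ' in (atTop : Filter (Finset L)), Λ' ∈ Set.Ici Λ := Ici_mem_atTop Λ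
      filter_upwards [hev.prod_mk hev] with m hm t _
      simp only [hstat Λ A hA t m.1 hm.1, hstat Λ A hA t m.2 hm.2]
      exact refl_mem_uniformity hu)
  refine ⟨τ, hτ, fun s Λ A hA => ?_⟩
  refine tendsto_nhds_unique ((hlim A |s|).tendsto_at (abs_le.mp le_rfl)) ?_
  refine tendsto_const_nhds.congr' ?_
  filter_upwards [Ici_mem_atTop Λ] with Λ' hΛ'
  exact (hstat Λ A hA s Λ' hΛ').symm

theorem commute_of_induces (hL : L.Countable) {n : L → QuasiLocal H} {γ : ℝ} {k : ℕ}
    {Φ : Interaction H} (hΦ : Φ.IsSymmetric n γ k) {a : Fin d → ℕ} (ha : ∑ j, a j ≤ k)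
    {α τ : ℝ → (QuasiLocal H ≃⋆ₐ[ℂ] QuasiLocal H)} (hα : Φ.Induces α)
    (hτ : IsMultipoleGroup n a τ) (t s : ℝ) (A : QuasiLocal H) :
    α t (τ s A) = τ s (α t A) := by
  obtain ⟨Λ, hΛ, hex⟩ := exists_exhaustion hL
  refine tendsto_nhds_unique (hα.tendsto_heisenberg hΛ hex t (τ s A)) ?_
  refine (((continuous_starAlgEquiv (τ s)).tendsto _).comp
    (hα.tendsto_heisenberg hΛ hex t A)).congr fun m => ?_
  -- On each term `τ_s` acts through the moment of that term's own region, which is the action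
  -- assumed to leave it invariant.
  have hinv : τ s (Φ.hamiltonian (Λ m)) = Φ.hamiltonian (Λ m) := by
    rw [Interaction.hamiltonian, map_sum]
    refine Finset.sum_congr rfl fun Z _ => ?_
    rw [hτ.apply_local s Z.1 _ (Φ.term_mem Z), hΦ.invariant a ha]
  rw [Function.comp_apply, map_heisenberg _ (continuous_starAlgEquiv _), hinv]

end Existence

end QuantumLattice

end

theorem mainTheorem6 {d : ℕ} (L : Set (EuclideanSpace ℝ (Fin d))) (γ : ℝ)
    (hL : QuantumLattice.HasEffectiveDimension L γ)
    (H : L → Type*) [∀ x, NormedAddCommGroup (H x)] [∀ x, InnerProductSpace ℂ (H x)]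
    [∀ x, FiniteDimensional ℂ (H x)] [∀ x, Nontrivial (H x)]
    (n : L → QuantumLattice.QuasiLocal H) (hn : QuantumLattice.IsChargeFamily n)
    (k : ℕ) (Φ : QuantumLattice.Interaction H) (hΦ : Φ.IsSymmetric n γ k) :
    (∃! α : ℝ → (QuantumLattice.QuasiLocal H ≃⋆ₐ[ℂ] QuantumLattice.QuasiLocal H), Φ.Induces α) ∧
    ∀ a : Fin d → ℕ, ∑ j, a j ≤ k →
      (∃! τ : ℝ → (QuantumLattice.QuasiLocal H ≃⋆ₐ[ℂ] QuantumLattice.QuasiLocal H),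
        QuantumLattice.IsMultipoleGroup n a τ) ∧
      ∀ α τ : ℝ → (QuantumLattice.QuasiLocal H ≃⋆ₐ[ℂ] QuantumLattice.QuasiLocal H),
        Φ.Induces α → QuantumLattice.IsMultipoleGroup n a τ →
        ∀ (t s : ℝ) (A : QuantumLattice.QuasiLocal H), α t (τ s A) = τ s (α t A) := by
  refine ⟨?_, fun a ha => ⟨?_, fun α τ hα hτ =>
    QuantumLattice.commute_of_induces hL.countable hΦ ha hα hτ⟩⟩
  · obtain ⟨α, hα⟩ := QuantumLattice.exists_induces hL hΦ
    exact ⟨α, hα, fun β hβ => hβ.unique hL.countable hα⟩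
  · obtain ⟨τ, hτ⟩ := hn.exists_isMultipoleGroup hL a
    exact ⟨τ, hτ, fun σ hσ => hσ.unique hτ⟩
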